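/- Let $k,p$ be positive integers with $k/p\in(0,1]$, let $\epsilon>0$, and let $A$ be a real $k\times p$ random matrix whose entries $A_{ij}$ are jointly independent and symmetrically distributed ($A_{ij}$ and $-A_{ij}$ have the same law), with zero mean and unit variance. For $\eta>0$ write $L_\eta=\log\det\left(\eta I+\frac1k AA^{\top}\right)$. Then each $L_\eta$, $\eta>0$, is integrable, and the following hold. (a) If $|A_{ij}|\le D$ almost surely for all $i,j$, then for every $\delta>\frac{8D\sqrt{\pi}}{\sqrt{\epsilon}}$, $$\mathbb{P}\left(L_{\epsilon}<\mathbb{E}\left[L_{2\epsilon/e}\right]-\delta\right)\le 4\exp\left(-\frac{\epsilon\delta^{2}}{16D^{2}}\right)\quad\text{and}\quad \mathbb{P}\left(L_{\epsilon}>\mathbb{E}\left[L_{e\epsilon/2}\right]+\delta\right)\le 4\exp\left(-\frac{\epsilon e\delta^{2}}{32D^{2}}\right).$$ (b) Say that a probability measure $\nu$ on $\mathbb{R}$ satisfies the logarithmic Sobolev inequality (LSI) with constant $c$ if, for every differentiable $g:\mathbb{R}\to\mathbb{R}$ with $g,g'\in L^2(\nu)$, the function $g^2\log\frac{g^2}{\int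 g^2\,d\nu}$ is $\nu$-integrable and $$\int g^{2}\log\frac{g^{2}}{\int g^{2}\,d\nu}\,d\nu\le 2c\int |g'|^{2}\,d\nu .$$ If the law of every entry $A_{ij}$ satisfies the LSI with one common constant $c_{\mathrm{LS}}$, then for every $\delta>0$, $$\mathbb{P}\left(\left|L_{\epsilon}-\mathbb{E}\left[L_{\epsilon}\right]\right|>\delta\right)\le 2\exp\left(-\frac{\epsilon\delta^{2}}{2c_{\mathrm{LS}}}\right).$$ -/

import Mathlib

open MeasureTheory ProbabilityTheory
open scoped Matrix

/-- `log det (η I + (1/k) M Mᵀ)` for a real `k × p` matrix `M`. -/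
noncomputable def logDetShift {k p : ℕ} (η : ℝ) (M : Matrix (Fin k) (Fin p) ℝ) : ℝ :=
  Real.log (η • (1 : Matrix (Fin k) (Fin k) ℝ) + (1 / (k : ℝ)) • (M * Mᵀ)).det

/-- A measure `ν` on `ℝ` satisfies the logarithmic Sobolev inequality with constant `c`: for
every differentiable `g`,
`∫ g² log (g² / ∫ g² dν) dν ≤ 2 c ∫ |g'|² dν`.
The left side is meaningful when `g ∈ L²(ν)`, and there is nothing to check when the right side
is infinite; in the remaining case the left side (an integral that is bounded below when `ν` is
a probability measure) is required to be finite and to obey the bound. -/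
def SatisfiesLSI (ν : Measure ℝ) (c : ℝ) : Prop :=
  ∀ g : ℝ → ℝ, Differentiable ℝ g →
    Integrable (fun x => g x ^ 2) ν →
    Integrable (fun x => |deriv g x| ^ 2) ν →
      Integrable (fun x => g x ^ 2 * Real.log (g x ^ 2 / ∫ y, g y ^ 2 ∂ν)) ν ∧
        ∫ x, g x ^ 2 * Real.log (g x ^ 2 / ∫ y, g y ^ 2 ∂ν) ∂ν
          ≤ 2 * c * ∫ x, |deriv g x| ^ 2 ∂ν

/-! ### Marton's transport-entropy inequality on finite product spaces -/

section TransportEntropy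

open Finset

/-! Both parts come from a sub-Gaussian bound `E exp(tF) ≤ exp(t E F + v t²/2)`, `t ≥ 0`, for `F =
L_η` and `F = -L_η`, followed by Chernoff's bound.

For bounded entries, `v = 8D²/η`. Let `H` be the symmetric dilation of `M/√k`. Up to an additive
constant, `2 L_η` is the trace of `log(η + x²)` applied to `H`. This scalar function is a difference
of two convex functions with slopes at most `1/√η`, and Klein's inequality lifts that to matrices:
`L_η(X) - L_η(Y) ≤ ⟨U(X) + V(Y), X - Y⟩` with `‖U‖², ‖V‖² ≤ 1/η` (`exists_logDetShift_sub_le`).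
Since one term depends on `X` alone and the other on `Y` alone, this is the hypothesis of Marton's
inequality (`sum_prod_mul_exp_le`), which is proved for finite alphabets and reaches bounded
variables by approximation (`integral_exp_le_of_bounded`). The result is two-sided concentration of
`L_η` about its own mean. Since `L_η` increases with `η` and `2/e < 1 < e/2`, the lower tail follows
at level `ε` from `E L_{2ε/e} ≤ E L_ε`, and the upper tail at level `eε/2` from `L_ε ≤ L_{eε/2}`.

Under the LSI, `v = c/η`. The gradient of `L_η` has Frobenius norm at most `1/√η`
(`sum_sq_logDetShiftGrad_le`), entropy is subadditive over independent coordinates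
(`entropyFun_pi_le`), and Herbst's argument (`integral_exp_le_of_entropyFun_le`) turns the resulting
entropy bound into one on exponential moments. A smooth truncation removes the boundedness needed
along the way. -/

lemma half_one_sub_sq_le_mul_log {q : ℝ} (hq : 0 < q) (hq1 : q ≤ 1) :
    (1 - q) ^ 2 / 2 ≤ q * Real.log q - q + 1 := by
  -- This is `x ≤ sinh x` at `x = -log q ≥ 0`, that is, `-log q ≤ (1/q - q)/2`.
  have h1 : -Real.log q ≤ Real.sinh (-Real.log q) := by
    rw [Real.self_le_sinh_iff]
    linarith [Real.log_nonpos hq.le hq1]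
  rw [Real.sinh_eq, neg_neg, Real.exp_neg, Real.exp_log hq] at h1
  have h2 : q * (-Real.log q) ≤ q * ((q⁻¹ - q) / 2) := by gcongr
  have h3 : q * ((q⁻¹ - q) / 2) = (1 - q ^ 2) / 2 := by field_simp
  nlinarith

lemma half_sub_one_sq_le_mul_log {q : ℝ} (hq1 : 1 ≤ q) :
    (q - 1) ^ 2 / (2 * q) ≤ q * Real.log q - q + 1 := by
  have hq : 0 < q := by linarith
  have hv0 : 0 ≤ 1 - q⁻¹ := by
    have := inv_le_one_of_one_le₀ hq1
    linarith
  have hv1 : |1 - q⁻¹| < 1 := by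
    rw [abs_of_nonneg hv0]
    have : 0 < q⁻¹ := by positivity
    linarith
  -- With `v = 1 - 1/q`, `log q = -log(1 - v)` is a series with nonnegative terms; the first two, `v
  -- + v²/2`, suffice.
  have h := sum_le_hasSum (Finset.range 2) (fun i _ => by positivity)
    (Real.hasSum_pow_div_log_of_abs_lt_one hv1)
  simp only [Finset.sum_range_succ, Finset.sum_range_zero, sub_sub_cancel, Real.log_inv] at h
  norm_num at h
  have h2 : q * (1 - q⁻¹ + (1 - q⁻¹) ^ 2 / 2) ≤ q * Real.log q := by gcongr
  have h3 : q * (1 - q⁻¹ + (1 - q⁻¹) ^ 2 / 2) = q - 1 + (q - 1) ^ 2 / (2 * q) := by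
    field_simp
  linarith

/-- Optimality of the maximal coupling between `μ` and `q μ`, in dual form. -/
lemma sum_density_sub_sum_le {α : Type*} [Fintype α] (μ q u w a b : α → ℝ)
    (hμ : ∀ s, 0 ≤ μ s) (hμ1 : ∑ s, μ s = 1) (hq : ∀ s, 0 < q s) (hq1 : ∑ s, μ s * q s = 1)
    (huw : ∀ s, u s ≤ w s) (hab : ∀ s t, u s - w t ≤ a s + b t) :
    ∑ s, μ s * (q s * u s) - ∑ s, μ s * w s
      ≤ ∑ s, μ s * (q s * (a s ^ 2 / 2)) + ∑ s, μ s * (b s ^ 2 / 2)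
        + ∑ s, μ s * (q s * Real.log (q s)) := by
  have hne : Nonempty α := by
    by_contra h
    rw [not_nonempty_iff] at h
    simp at hμ1
  obtain ⟨t₀, ht₀⟩ := Finite.exists_min (fun t => w t + b t)
  -- The level `m` separates the two sides: `u ≤ a + m` and `w ≥ m - b` everywhere.
  set m := w t₀ + b t₀
  have hum : ∀ s, u s ≤ a s + m := fun s => by linarith [hab s t₀]
  -- The last two terms are multiples of `μ - μq` and cancel on summation. Where `q ≤ 1` the missing
  -- mass `1 - q` is charged to `b`, where `q ≥ 1` the excess `q - 1` is charged to `a`; in both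
  -- cases `q log q - q + 1` pays for the square completed.
  have key : ∀ s, μ s * (q s * u s) - μ s * w s ≤
      μ s * (q s * (a s ^ 2 / 2)) + μ s * (b s ^ 2 / 2) + μ s * (q s * Real.log (q s))
        + (m + 1) * (μ s - μ s * q s) + m * 2 * (μ s * q s - μ s) := by
    intro s
    have h : q s * u s - w s ≤ q s * (a s ^ 2 / 2) + b s ^ 2 / 2 + q s * Real.log (q s)
        + (1 - q s) + m * (q s - 1) := by
      have hqs := hq s
      rcases le_total (q s) 1 with h1 | h1
      · have e := half_one_sub_sq_le_mul_log hqs h1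
        have e1 : q s * u s ≤ q s * w s := by gcongr; exact huw s
        have e2 : (1 - q s) * (m - b s) ≤ (1 - q s) * w s :=
          mul_le_mul_of_nonneg_left (by linarith [ht₀ s]) (by linarith)
        have e3 : 0 ≤ q s * (a s ^ 2 / 2) := by positivity
        nlinarith [sq_nonneg (b s - (1 - q s))]
      · have e := half_sub_one_sq_le_mul_log h1
        have e2 : (q s - 1) * u s ≤ (q s - 1) * (a s + m) :=
          mul_le_mul_of_nonneg_left (hum s) (by linarith)
        have e3 : (q s - 1) * a s ≤ q s * (a s ^ 2 / 2) + (q s - 1) ^ 2 / (2 * q s) := by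
          rw [← sub_nonneg]
          have : q s * (a s ^ 2 / 2) + (q s - 1) ^ 2 / (2 * q s) - (q s - 1) * a s
              = (q s * a s - (q s - 1)) ^ 2 / (2 * q s) := by
            field_simp
            ring
          rw [this]
          positivity
        nlinarith [sq_nonneg (b s), huw s]
    have := mul_le_mul_of_nonneg_left h (hμ s)
    nlinarith
  have := Finset.sum_le_sum (fun s (_ : s ∈ Finset.univ) => key s)
  simp only [Finset.sum_add_distrib, Finset.sum_sub_distrib, ← Finset.mul_sum, hμ1, hq1] at this
  linarith

lemma Fin.sum_univ_pi_succ {α : Type*} [Fintype α] {n : ℕ} (f : (Fin (n + 1) → α) → ℝ) :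
    ∑ x, f x = ∑ x : Fin n → α, ∑ s : α, f (Fin.cons s x) := by
  rw [← (Fin.consEquiv (fun _ : Fin (n + 1) => α)).sum_comp, Fintype.sum_prod_type,
    Finset.sum_comm]
  rfl

/-- Marton's transport-entropy inequality for product measures on finite spaces, in the form of
a bound on exponential moments. -/
theorem sum_prod_mul_exp_le {α : Type*} [Fintype α] [DecidableEq α] :
    ∀ {n : ℕ} (w : Fin n → α → ℝ) (_ : ∀ i s, 0 ≤ w i s) (_ : ∀ i, ∑ s, w i s = 1)
      (φ ψ : (Fin n → α) → ℝ) (a b : Fin n → (Fin n → α) → ℝ)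
      (_ : ∀ i x, 0 ≤ a i x) (_ : ∀ i x, 0 ≤ b i x)
      (_ : ∀ x y, φ x - ψ y ≤ ∑ i, if x i = y i then 0 else a i x + b i y),
      ∑ x : Fin n → α, (∏ i, w i (x i)) * Real.exp (φ x - ∑ i, a i x ^ 2 / 2)
        ≤ Real.exp (∑ x : Fin n → α, (∏ i, w i (x i)) * (ψ x + ∑ i, b i x ^ 2 / 2)) := by
  intro n
  induction n with
  | zero =>
    intro w _ _ φ ψ a b _ _ h
    simpa using h default default
  | succ n ih =>
    intro w hw hw1 φ ψ a b ha0 hb0 h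
    -- Coordinate `0` is integrated out: `Z` is its partial exponential integral and `q` below is
    -- the corresponding Gibbs density.
    set Z : (Fin n → α) → ℝ := fun x =>
      ∑ s, w 0 s * Real.exp (φ (Fin.cons s x) - ∑ i, a i (Fin.cons s x) ^ 2 / 2) with hZ
    have hZpos : ∀ x, 0 < Z x := by
      intro x
      obtain ⟨s, hs⟩ : ∃ s, w 0 s ≠ 0 := by
        by_contra hcon
        push Not at hcon
        have := hw1 0
        simp [hcon] at this
      refine Finset.sum_pos' (fun s _ => mul_nonneg (hw 0 s) (Real.exp_pos _).le)
        ⟨s, Finset.mem_univ _, mul_pos (lt_of_le_of_ne (hw 0 s) hs.symm) (Real.exp_pos _)⟩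
    set q : (Fin n → α) → α → ℝ := fun x s =>
      Real.exp (φ (Fin.cons s x) - ∑ i, a i (Fin.cons s x) ^ 2 / 2) / Z x with hq
    have hqpos : ∀ x s, 0 < q x s := fun x s => div_pos (Real.exp_pos _) (hZpos x)
    have hq1 : ∀ x, ∑ s, w 0 s * q x s = 1 := by
      intro x
      have e : ∀ s, w 0 s * q x s = w 0 s * Real.exp
          (φ (Fin.cons s x) - ∑ i, a i (Fin.cons s x) ^ 2 / 2) / Z x := fun s => by
        rw [hq, mul_div_assoc]
      rw [Finset.sum_congr rfl fun s _ => e s, ← Finset.sum_div]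
      exact div_self (hZpos x).ne'
    have hlogq : ∀ x s, Real.log (q x s) =
        φ (Fin.cons s x) - ∑ i, a i (Fin.cons s x) ^ 2 / 2 - Real.log (Z x) := by
      intro x s
      rw [hq, Real.log_div (Real.exp_pos _).ne' (hZpos x).ne', Real.log_exp]
    -- The Gibbs variational identity writes `log Z` as the `q`-average of `φ - ∑ a²/2` minus the
    -- entropy of `q`; `φ'` is this expression without the squares of the remaining coordinates.
    -- Data on the `φ` side are averaged under the tilted law, data on the `ψ` side under `w 0`.
    set φ' : (Fin n → α) → ℝ := fun x =>
      ∑ s, w 0 s * (q x s * φ (Fin.cons s x)) - ∑ s, w 0 s * (q x s * (a 0 (Fin.cons s x) ^ 2 / 2))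
        - ∑ s, w 0 s * (q x s * Real.log (q x s)) with hφ'
    set ψ' : (Fin n → α) → ℝ := fun y =>
      ∑ s, w 0 s * ψ (Fin.cons s y) + ∑ s, w 0 s * (b 0 (Fin.cons s y) ^ 2 / 2) with hψ'
    set a' : Fin n → (Fin n → α) → ℝ := fun i x =>
      ∑ s, w 0 s * (q x s * a i.succ (Fin.cons s x)) with ha'
    set b' : Fin n → (Fin n → α) → ℝ := fun i y =>
      ∑ s, w 0 s * b i.succ (Fin.cons s y) with hb'
    have hsplit : ∀ (x y : Fin n → α) (s t : α), ∑ i : Fin n, (if x i = y i then 0 else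
          a i.succ (Fin.cons s x) + b i.succ (Fin.cons t y))
        = (∑ i, if x i = y i then 0 else a i.succ (Fin.cons s x))
          + ∑ i, if x i = y i then 0 else b i.succ (Fin.cons t y) := by
      intro x y s t
      rw [← Finset.sum_add_distrib]
      refine Finset.sum_congr rfl fun i _ => ?_
      split_ifs <;> simp
    have hstep : ∀ x y, φ' x - ψ' y ≤ ∑ i, if x i = y i then 0 else a' i x + b' i y := by
      intro x y
      -- With `x` and `y` frozen, the costs of the other coordinates are absorbed into the two
      -- functions, so only coordinate `0` is coupled.
      have := sum_density_sub_sum_le (w 0) (q x)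
        (fun s => φ (Fin.cons s x) - ∑ i, if x i = y i then 0 else a i.succ (Fin.cons s x))
        (fun t => ψ (Fin.cons t y) + ∑ i, if x i = y i then 0 else b i.succ (Fin.cons t y))
        (fun s => a 0 (Fin.cons s x)) (fun t => b 0 (Fin.cons t y))
        (hw 0) (hw1 0) (hqpos x) (hq1 x)
        (by
          intro s
          have := h (Fin.cons s x) (Fin.cons s y)
          simp only [Fin.sum_univ_succ, Fin.cons_zero, Fin.cons_succ, if_true, zero_add] at this
          linarith [hsplit x y s s])
        (by
          intro s t
          have := h (Fin.cons s x) (Fin.cons t y)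
          simp only [Fin.sum_univ_succ, Fin.cons_zero, Fin.cons_succ] at this
          have h0 : (if s = t then 0 else a 0 (Fin.cons s x) + b 0 (Fin.cons t y))
              ≤ a 0 (Fin.cons s x) + b 0 (Fin.cons t y) := by
            have := ha0 0 (Fin.cons s x)
            have := hb0 0 (Fin.cons t y)
            split_ifs <;> linarith
          linarith [hsplit x y s t])
      have e1 : ∑ s, w 0 s * (q x s * (φ (Fin.cons s x)
            - ∑ i, if x i = y i then 0 else a i.succ (Fin.cons s x)))
          = ∑ s, w 0 s * (q x s * φ (Fin.cons s x)) - ∑ i, if x i = y i then 0 else a' i x := by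
        simp only [mul_sub, Finset.sum_sub_distrib, Finset.mul_sum]
        congr 1
        rw [Finset.sum_comm]
        refine Finset.sum_congr rfl fun i _ => ?_
        split_ifs <;> simp [ha']
      have e2 : ∑ t, w 0 t * (ψ (Fin.cons t y)
            + ∑ i, if x i = y i then 0 else b i.succ (Fin.cons t y))
          = ∑ t, w 0 t * ψ (Fin.cons t y) + ∑ i, if x i = y i then 0 else b' i y := by
        simp only [mul_add, Finset.sum_add_distrib, Finset.mul_sum]
        congr 1
        rw [Finset.sum_comm]
        refine Finset.sum_congr rfl fun i _ => ?_
        split_ifs <;> simp [hb']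
      have e3 : ∑ i : Fin n, (if x i = y i then 0 else a' i x + b' i y)
          = (∑ i, if x i = y i then 0 else a' i x) + ∑ i, if x i = y i then 0 else b' i y := by
        rw [← Finset.sum_add_distrib]
        refine Finset.sum_congr rfl fun i _ => ?_
        split_ifs <;> simp
      rw [e1, e2] at this
      rw [e3]
      simp only [hφ', hψ']
      linarith
    have hjensen : ∀ (ρ f : α → ℝ), (∀ s, 0 ≤ ρ s) → ∑ s, ρ s = 1 →
        (∑ s, ρ s * f s) ^ 2 ≤ ∑ s, ρ s * f s ^ 2 := fun ρ f h0 h1 => by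
      simpa using (Even.convexOn_pow (𝕜 := ℝ) (n := 2) even_two).map_sum_le (t := Finset.univ)
        (w := ρ) (p := f) (fun s _ => h0 s) h1 (fun _ _ => Set.mem_univ _)
    -- The formula for `log Z` is exact; the only loss is Jensen's inequality, replacing averages of
    -- `a²` by squares of averages.
    have hZle : ∀ x, Z x ≤ Real.exp (φ' x - ∑ i, a' i x ^ 2 / 2) := by
      intro x
      rw [← Real.log_le_iff_le_exp (hZpos x)]
      have e1 : Real.log (Z x) = ∑ s, w 0 s * (q x s * φ (Fin.cons s x))
          - ∑ s, w 0 s * (q x s * ∑ i, a i (Fin.cons s x) ^ 2 / 2)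
          - ∑ s, w 0 s * (q x s * Real.log (q x s)) := by
        rw [← Finset.sum_sub_distrib, ← Finset.sum_sub_distrib]
        have : ∀ s, w 0 s * (q x s * φ (Fin.cons s x))
            - w 0 s * (q x s * ∑ i, a i (Fin.cons s x) ^ 2 / 2)
            - w 0 s * (q x s * Real.log (q x s)) = w 0 s * q x s * Real.log (Z x) := by
          intro s
          rw [hlogq]
          ring
        rw [Finset.sum_congr rfl fun s _ => this s, ← Finset.sum_mul, hq1, one_mul]
      have e2 : ∑ s, w 0 s * (q x s * ∑ i, a i (Fin.cons s x) ^ 2 / 2)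
          = ∑ s, w 0 s * (q x s * (a 0 (Fin.cons s x) ^ 2 / 2))
            + ∑ i : Fin n, (∑ s, (w 0 s * q x s) * a i.succ (Fin.cons s x) ^ 2) / 2 := by
        simp only [Fin.sum_univ_succ, mul_add, Finset.sum_add_distrib, Finset.mul_sum,
          Finset.sum_div]
        congr 1
        rw [Finset.sum_comm]
        refine Finset.sum_congr rfl fun i _ => Finset.sum_congr rfl fun s _ => ?_
        ring
      have e3 : ∑ i, a' i x ^ 2 / 2
          ≤ ∑ i : Fin n, (∑ s, (w 0 s * q x s) * a i.succ (Fin.cons s x) ^ 2) / 2 := by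
        refine Finset.sum_le_sum fun i _ => ?_
        have := hjensen (fun s => w 0 s * q x s) (fun s => a i.succ (Fin.cons s x))
          (fun s => mul_nonneg (hw 0 s) (hqpos x s).le) (hq1 x)
        simp only [mul_assoc] at this
        simp only [ha', mul_assoc]
        linarith
      simp only [hφ']
      linarith
    have hprod0 : ∀ x : Fin n → α, 0 ≤ ∏ i : Fin n, w i.succ (x i) :=
      fun x => Finset.prod_nonneg fun i _ => hw _ _
    have hind := ih (fun i => w i.succ) (fun i => hw i.succ) (fun i => hw1 i.succ) φ' ψ' a' b'
      (fun i x => Finset.sum_nonneg fun s _ =>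
        mul_nonneg (hw 0 s) (mul_nonneg (hqpos x s).le (ha0 _ _)))
      (fun i x => Finset.sum_nonneg fun s _ => mul_nonneg (hw 0 s) (hb0 _ _)) hstep
    calc ∑ x : Fin (n + 1) → α, (∏ i, w i (x i)) * Real.exp (φ x - ∑ i, a i x ^ 2 / 2)
        = ∑ x : Fin n → α, (∏ i : Fin n, w i.succ (x i)) * Z x := by
          rw [Fin.sum_univ_pi_succ]
          refine Finset.sum_congr rfl fun x _ => ?_
          rw [hZ, Finset.mul_sum]
          refine Finset.sum_congr rfl fun s _ => ?_
          rw [Fin.prod_univ_succ, Fin.cons_zero]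
          simp only [Fin.cons_succ]
          ring
      _ ≤ ∑ x : Fin n → α, (∏ i : Fin n, w i.succ (x i))
            * Real.exp (φ' x - ∑ i, a' i x ^ 2 / 2) :=
          Finset.sum_le_sum fun x _ => mul_le_mul_of_nonneg_left (hZle x) (hprod0 x)
      _ ≤ _ := hind
      _ ≤ _ := by
          rw [Real.exp_le_exp, Fin.sum_univ_pi_succ]
          refine Finset.sum_le_sum fun x _ => ?_
          have e : ∑ s, (∏ i, w i ((Fin.cons s x : Fin (n + 1) → α) i))
              * (ψ (Fin.cons s x) + ∑ i, b i (Fin.cons s x) ^ 2 / 2)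
              = (∏ i : Fin n, w i.succ (x i)) * (ψ' x
                + ∑ i : Fin n, (∑ s, w 0 s * b i.succ (Fin.cons s x) ^ 2) / 2) := by
            simp only [Fin.prod_univ_succ, Fin.cons_zero, Fin.cons_succ, hψ', Fin.sum_univ_succ]
            simp only [Finset.sum_div]
            rw [Finset.sum_comm (s := (Finset.univ : Finset (Fin n))),
              ← Finset.sum_add_distrib, ← Finset.sum_add_distrib, Finset.mul_sum]
            refine Finset.sum_congr rfl fun s _ => ?_
            have : ∑ i : Fin n, w 0 s * b i.succ (Fin.cons s x) ^ 2 / 2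
                = w 0 s * ∑ i : Fin n, b i.succ (Fin.cons s x) ^ 2 / 2 := by
              rw [Finset.mul_sum]
              exact Finset.sum_congr rfl fun i _ => by ring
            rw [this]
            ring
          rw [e]
          refine mul_le_mul_of_nonneg_left ?_ (hprod0 x)
          gcongr with i
          exact hjensen (w 0) (fun s => b i.succ (Fin.cons s x)) (hw 0) (hw1 0)

end TransportEntropy

/-! ### Splitting `log (ε + x²)` into a difference of convex functions -/

section ScalarDecomposition

/-- The derivative of `x ↦ log (ε + x ^ 2)`, frozen outside of `[-√ε, √ε]`. -/
noncomputable def clampedLogDeriv (ε x : ℝ) : ℝ :=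
  2 * max (-√ε) (min x √ε) / (ε + max (-√ε) (min x √ε) ^ 2)

variable {ε : ℝ}

lemma continuous_two_mul_div (hε : 0 < ε) : Continuous fun x : ℝ => 2 * x / (ε + x ^ 2) :=
  Continuous.div (by fun_prop) (by fun_prop) fun x => by positivity

lemma continuous_clampedLogDeriv (hε : 0 < ε) : Continuous (clampedLogDeriv ε) :=
  (continuous_two_mul_div hε).comp (continuous_const.max (continuous_id.min continuous_const))

/-- After clearing denominators the difference is a multiple of `(y - x)(ε - xy)`; the next lemma is
the opposite sign. -/
lemma two_mul_div_le_of_mul_le (hε : 0 < ε) {x y : ℝ} (hxy : x ≤ y) (h : x * y ≤ ε) :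
    2 * x / (ε + x ^ 2) ≤ 2 * y / (ε + y ^ 2) := by
  rw [div_le_div_iff₀ (by positivity) (by positivity)]
  nlinarith [mul_nonneg (sub_nonneg.2 hxy) (sub_nonneg.2 h)]

lemma two_mul_div_le_of_le_mul (hε : 0 < ε) {x y : ℝ} (hxy : x ≤ y) (h : ε ≤ x * y) :
    2 * y / (ε + y ^ 2) ≤ 2 * x / (ε + x ^ 2) := by
  rw [div_le_div_iff₀ (by positivity) (by positivity)]
  nlinarith [mul_nonneg (sub_nonneg.2 hxy) (sub_nonneg.2 h)]

lemma clampedLogDeriv_of_le {x : ℝ} (hx : √ε ≤ x) :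
    clampedLogDeriv ε x = 2 * √ε / (ε + √ε ^ 2) := by
  have : -√ε ≤ √ε := by linarith [Real.sqrt_nonneg ε]
  rw [clampedLogDeriv, min_eq_right hx, max_eq_right this]

lemma clampedLogDeriv_of_le_neg {x : ℝ} (hx : x ≤ -√ε) :
    clampedLogDeriv ε x = 2 * (-√ε) / (ε + (-√ε) ^ 2) := by
  have : x ≤ √ε := by linarith [Real.sqrt_nonneg ε]
  rw [clampedLogDeriv, min_eq_left this, max_eq_left hx]

lemma clampedLogDeriv_of_mem {x : ℝ} (h1 : -√ε ≤ x) (h2 : x ≤ √ε) :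
    clampedLogDeriv ε x = 2 * x / (ε + x ^ 2) := by
  rw [clampedLogDeriv, min_eq_left h2, max_eq_right h1]

lemma monotone_clampedLogDeriv (hε : 0 < ε) : Monotone (clampedLogDeriv ε) := by
  intro x y hxy
  have hs := Real.sq_sqrt hε.le
  have hr := Real.sqrt_nonneg ε
  have hx1 : -√ε ≤ max (-√ε) (min x √ε) := le_max_left _ _
  have hx2 : max (-√ε) (min x √ε) ≤ √ε := max_le (by linarith) (min_le_right _ _)
  have hy1 : -√ε ≤ max (-√ε) (min y √ε) := le_max_left _ _
  have hy2 : max (-√ε) (min y √ε) ≤ √ε := max_le (by linarith) (min_le_right _ _)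
  refine two_mul_div_le_of_mul_le hε (by gcongr) ?_
  nlinarith

/-- The function vanishes on `[-√ε, √ε]`. On either side it is a constant minus `2x/(ε + x²)`, which
decreases there because products of two points are at least `ε`. -/
lemma monotone_clampedLogDeriv_sub (hε : 0 < ε) :
    Monotone fun x => clampedLogDeriv ε x - 2 * x / (ε + x ^ 2) := by
  have hs := Real.sq_sqrt hε.le
  have hr : 0 < √ε := Real.sqrt_pos.2 hε
  have h1 : MonotoneOn (fun x => clampedLogDeriv ε x - 2 * x / (ε + x ^ 2)) (Set.Iic (-√ε)) := by
    intro x hx y hy hxy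
    simp only [Set.mem_Iic] at hx hy
    simp only [clampedLogDeriv_of_le_neg hx, clampedLogDeriv_of_le_neg hy]
    have := two_mul_div_le_of_le_mul hε hxy (by nlinarith)
    linarith
  have h2 : MonotoneOn (fun x => clampedLogDeriv ε x - 2 * x / (ε + x ^ 2))
      (Set.Icc (-√ε) √ε) := by
    intro x hx y hy hxy
    simp only [clampedLogDeriv_of_mem hx.1 hx.2, clampedLogDeriv_of_mem hy.1 hy.2, sub_self,
      le_refl]
  have h3 : MonotoneOn (fun x => clampedLogDeriv ε x - 2 * x / (ε + x ^ 2)) (Set.Ici √ε) := by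
    intro x hx y hy hxy
    simp only [Set.mem_Ici] at hx hy
    simp only [clampedLogDeriv_of_le hx, clampedLogDeriv_of_le hy]
    have := two_mul_div_le_of_le_mul hε hxy (by nlinarith)
    linarith
  have h12 := h1.union_right h2 (isGreatest_Iic) (isLeast_Icc (by linarith))
  rw [Set.Iic_union_Icc_eq_Iic (by linarith)] at h12
  have h := h12.union_right h3 isGreatest_Iic isLeast_Ici
  rwa [Set.Iic_union_Ici, monotoneOn_univ] at h

lemma sq_clampedLogDeriv_le (hε : 0 < ε) (x : ℝ) : clampedLogDeriv ε x ^ 2 ≤ 1 / ε := by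
  rw [clampedLogDeriv, div_pow, div_le_div_iff₀ (by positivity) hε]
  nlinarith [sq_nonneg (ε - max (-√ε) (min x √ε) ^ 2)]

/-- The difference is monotone and zero at `0`, and `2x/(ε + x²)` has the sign of `x`; hence it lies
between `0` and `clampedLogDeriv ε x`. -/
lemma sq_clampedLogDeriv_sub_le (hε : 0 < ε) (x : ℝ) :
    (clampedLogDeriv ε x - 2 * x / (ε + x ^ 2)) ^ 2 ≤ 1 / ε := by
  have hr : 0 < √ε := Real.sqrt_pos.2 hε
  have hm := monotone_clampedLogDeriv_sub hε
  have h00 : clampedLogDeriv ε 0 = 0 := by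
    rw [clampedLogDeriv_of_mem (by linarith) hr.le]
    simp
  have hsq := sq_clampedLogDeriv_le hε x
  refine le_trans ?_ hsq
  rcases le_total 0 x with h | h
  · have e1 := hm h
    have e2 : 0 ≤ 2 * x / (ε + x ^ 2) := by positivity
    simp only [h00] at e1
    norm_num at e1
    exact pow_le_pow_left₀ (by linarith) (by linarith) 2
  · have e1 := hm h
    have e2 : 2 * x / (ε + x ^ 2) ≤ 0 := div_nonpos_of_nonpos_of_nonneg (by linarith) (by positivity)
    simp only [h00] at e1
    norm_num at e1
    rw [← neg_sq, ← neg_sq (clampedLogDeriv ε x)]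
    exact pow_le_pow_left₀ (by linarith) (by linarith) 2

/-- Convexity of the primitive as a subgradient inequality, the form that Klein's inequality takes
as input. -/
lemma integral_sub_integral_ge_of_monotone {m : ℝ → ℝ} (hm : Monotone m) (hc : Continuous m)
    (s t : ℝ) : m s * (t - s) ≤ (∫ x in (0)..t, m x) - ∫ x in (0)..s, m x := by
  have hi : ∀ a b, IntervalIntegrable m volume a b := fun a b => hc.intervalIntegrable a b
  rw [intervalIntegral.integral_interval_sub_left (hi _ _) (hi _ _)]
  rcases le_total s t with h | h
  · have := intervalIntegral.integral_mono_on h (by simp : IntervalIntegrable (fun _ => m s) volume s t) (hi s t)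
      (fun x hx => hm hx.1)
    simpa [mul_comm] using this
  · rw [intervalIntegral.integral_symm]
    have := intervalIntegral.integral_mono_on h (hi t s) (by simp : IntervalIntegrable (fun _ => m s) volume t s)
      (fun x hx => hm hx.2)
    simp at this
    linarith

lemma integral_two_mul_div (hε : 0 < ε) (t : ℝ) :
    ∫ x in (0)..t, 2 * x / (ε + x ^ 2) = Real.log (ε + t ^ 2) - Real.log ε := by
  rw [intervalIntegral.integral_eq_sub_of_hasDerivAt (f := fun x => Real.log (ε + x ^ 2))]
  · simp
  · intro x _
    have := ((hasDerivAt_pow 2 x).const_add ε).log (by positivity)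
    simpa using this
  · exact (continuous_two_mul_div hε).intervalIntegrable _ _

/-- `x ↦ log (ε + x ^ 2)` is a difference of two convex functions with `1/√ε`-bounded slopes. -/
lemma exists_log_add_sq_eq_sub (hε : 0 < ε) : ∃ g₁ g₂ m₁ m₂ : ℝ → ℝ,
    (∀ x, g₁ x - g₂ x = Real.log (ε + x ^ 2)) ∧
    (∀ s t, m₁ s * (t - s) ≤ g₁ t - g₁ s) ∧ (∀ s t, m₂ s * (t - s) ≤ g₂ t - g₂ s) ∧
    (∀ x, m₁ x ^ 2 ≤ 1 / ε) ∧ (∀ x, m₂ x ^ 2 ≤ 1 / ε) := by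
  have hc := continuous_clampedLogDeriv hε
  have hc' := continuous_two_mul_div hε
  refine ⟨fun t => Real.log ε + ∫ x in (0)..t, clampedLogDeriv ε x,
    fun t => ∫ x in (0)..t, (clampedLogDeriv ε x - 2 * x / (ε + x ^ 2)),
    clampedLogDeriv ε, fun x => clampedLogDeriv ε x - 2 * x / (ε + x ^ 2), ?_, ?_, ?_,
    sq_clampedLogDeriv_le hε, sq_clampedLogDeriv_sub_le hε⟩
  · intro x
    simp only
    rw [intervalIntegral.integral_sub (hc.intervalIntegrable _ _) (hc'.intervalIntegrable _ _),
      integral_two_mul_div hε]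
    ring
  · intro s t
    have := integral_sub_integral_ge_of_monotone (monotone_clampedLogDeriv hε) hc s t
    simpa using this
  · intro s t
    exact integral_sub_integral_ge_of_monotone (monotone_clampedLogDeriv_sub hε) (hc.sub hc') s t

end ScalarDecomposition

/-! ### Spectral calculus and Klein's inequality -/

section Spectral

open Matrix

variable {n : Type*} [Fintype n] [DecidableEq n]

lemma Matrix.IsSymm.exists_diagonalization {H : Matrix n n ℝ} (hH : H.IsSymm) :
    ∃ (Q : Matrix n n ℝ) (μ : n → ℝ), Q * Qᵀ = 1 ∧ Qᵀ * Q = 1 ∧ H = Q * diagonal μ * Qᵀ := by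
  have hH' : H.IsHermitian := by
    rw [Matrix.IsHermitian, conjTranspose_eq_transpose_of_trivial]
    exact hH
  have h1 := Unitary.mul_star_self_of_mem hH'.eigenvectorUnitary.2
  have h2 := Unitary.star_mul_self_of_mem hH'.eigenvectorUnitary.2
  rw [star_eq_conjTranspose, conjTranspose_eq_transpose_of_trivial] at h1 h2
  refine ⟨hH'.eigenvectorUnitary, hH'.eigenvalues, h1, h2, ?_⟩
  have := hH'.spectral_theorem
  simpa [Unitary.conjStarAlgAut_apply, star_eq_conjTranspose,
    conjTranspose_eq_transpose_of_trivial, Function.comp_def] using this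

lemma mul_diagonal_mul_transpose_apply (Q : Matrix n n ℝ) (d : n → ℝ) (a b : n) :
    (Q * diagonal d * Qᵀ) a b = ∑ i, d i * (Q a i * Q b i) := by
  rw [Matrix.mul_apply]
  refine Finset.sum_congr rfl fun i _ => ?_
  rw [mul_diagonal, transpose_apply]
  ring

lemma det_smul_one_add_sq {Q : Matrix n n ℝ} (h : Q * Qᵀ = 1) (h' : Qᵀ * Q = 1) (μ : n → ℝ)
    (ε : ℝ) : (ε • (1 : Matrix n n ℝ) + (Q * diagonal μ * Qᵀ) * (Q * diagonal μ * Qᵀ)).det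
      = ∏ i, (ε + μ i ^ 2) := by
  have e : ε • (1 : Matrix n n ℝ) + (Q * diagonal μ * Qᵀ) * (Q * diagonal μ * Qᵀ)
      = Q * diagonal (fun i => ε + μ i ^ 2) * Qᵀ := by
    have e1 : (Q * diagonal μ * Qᵀ) * (Q * diagonal μ * Qᵀ)
        = Q * (diagonal μ * diagonal μ) * Qᵀ := by
      calc _ = Q * diagonal μ * (Qᵀ * Q) * diagonal μ * Qᵀ := by simp only [Matrix.mul_assoc]
        _ = _ := by rw [h', Matrix.mul_one]; simp only [Matrix.mul_assoc]
    have e2 : diagonal (fun i => ε + μ i ^ 2)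
        = ε • (1 : Matrix n n ℝ) + diagonal μ * diagonal μ := by
      rw [diagonal_mul_diagonal, smul_one_eq_diagonal, diagonal_add]
      simp [sq]
    rw [e1, e2, Matrix.mul_add, Matrix.add_mul, Matrix.mul_smul, Matrix.mul_one, Matrix.smul_mul,
      h]
  rw [e, det_mul, det_mul, det_diagonal, mul_right_comm, ← det_mul, h, det_one, one_mul]

/-- The sum is a diagonal entry of `Q diag(d²) Qᵀ`, an average of the `d i ^ 2` with weights `Q a i
^ 2`. A bound per row, rather than on the whole matrix, keeps the later gradient estimate free of
`p`. -/
lemma sum_sq_mul_diagonal_mul_transpose_le {Q : Matrix n n ℝ} (h : Q * Qᵀ = 1) (h' : Qᵀ * Q = 1)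
    {d : n → ℝ} {B : ℝ} (hd : ∀ i, d i ^ 2 ≤ B) (a : n) :
    ∑ b, (Q * diagonal d * Qᵀ) a b ^ 2 ≤ B := by
  have e1 : ∑ b, (Q * diagonal d * Qᵀ) a b ^ 2
      = ((Q * diagonal d * Qᵀ) * (Q * diagonal d * Qᵀ)ᵀ) a a := by
    rw [Matrix.mul_apply]
    exact Finset.sum_congr rfl fun b _ => by rw [transpose_apply, sq]
  have e2 : (Q * diagonal d * Qᵀ) * (Q * diagonal d * Qᵀ)ᵀ
      = Q * diagonal (fun i => d i ^ 2) * Qᵀ := by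
    have : diagonal (fun i => d i ^ 2) = diagonal d * diagonal d := by
      rw [diagonal_mul_diagonal]
      simp [sq]
    rw [this]
    calc _ = Q * diagonal d * (Qᵀ * Q) * diagonal d * Qᵀ := by
          simp only [transpose_mul, transpose_transpose, diagonal_transpose, Matrix.mul_assoc]
      _ = _ := by rw [h', Matrix.mul_one]; simp only [Matrix.mul_assoc]
  have e3 : ∑ i, Q a i * Q a i = 1 := by
    have := congrFun (congrFun h a) a
    rw [Matrix.mul_apply, one_apply_eq] at this
    simpa using this
  rw [e1, e2, mul_diagonal_mul_transpose_apply]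
  calc ∑ i, d i ^ 2 * (Q a i * Q a i) ≤ ∑ i, B * (Q a i * Q a i) :=
        Finset.sum_le_sum fun i _ => mul_le_mul_of_nonneg_right (hd i) (mul_self_nonneg _)
    _ = B := by rw [← Finset.mul_sum, e3, mul_one]

/-- Klein's inequality. -/
lemma klein_inequality {Q R : Matrix n n ℝ} (hQ : Q * Qᵀ = 1) (hQ' : Qᵀ * Q = 1)
    (hR : R * Rᵀ = 1) (hR' : Rᵀ * R = 1) (μ ν : n → ℝ) {g m : ℝ → ℝ}
    (hg : ∀ s t, m s * (t - s) ≤ g t - g s) :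
    ((Q * diagonal (fun i => m (μ i)) * Qᵀ) * (R * diagonal ν * Rᵀ - Q * diagonal μ * Qᵀ)).trace
      ≤ ∑ i, g (ν i) - ∑ i, g (μ i) := by
  -- `C` is orthogonal, so its squared entries form a doubly stochastic matrix. The claim is the
  -- scalar subgradient inequality between `μ i` and `ν j`, averaged with these weights.
  set C := Qᵀ * R with hC
  have hC1 : C * Cᵀ = 1 := by
    rw [hC, transpose_mul, transpose_transpose]
    calc _ = Qᵀ * (R * Rᵀ) * Q := by simp only [Matrix.mul_assoc]
      _ = 1 := by rw [hR, Matrix.mul_one, hQ']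
  have hC2 : Cᵀ * C = 1 := by
    rw [hC, transpose_mul, transpose_transpose]
    calc _ = Rᵀ * (Q * Qᵀ) * R := by simp only [Matrix.mul_assoc]
      _ = 1 := by rw [hQ, Matrix.mul_one, hR']
  have hrow : ∀ i, ∑ j, C i j ^ 2 = 1 := fun i => by
    have := congrFun (congrFun hC1 i) i
    rw [Matrix.mul_apply, one_apply_eq] at this
    simpa [sq] using this
  have hcol : ∀ j, ∑ i, C i j ^ 2 = 1 := fun j => by
    have := congrFun (congrFun hC2 j) j
    rw [Matrix.mul_apply, one_apply_eq] at this
    simpa [sq] using this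
  have e1 : ((Q * diagonal (fun i => m (μ i)) * Qᵀ)
      * (R * diagonal ν * Rᵀ - Q * diagonal μ * Qᵀ)).trace
      = (diagonal (fun i => m (μ i)) * (C * diagonal ν * Cᵀ - diagonal μ)).trace := by
    rw [Matrix.mul_assoc, Matrix.mul_assoc, trace_mul_comm]
    congr 1
    rw [Matrix.mul_assoc]
    congr 1
    rw [Matrix.mul_sub, Matrix.sub_mul, hC, transpose_mul, transpose_transpose]
    congr 1
    · simp only [Matrix.mul_assoc]
    · calc _ = (Qᵀ * Q) * diagonal μ * (Qᵀ * Q) := by simp only [Matrix.mul_assoc]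
        _ = _ := by rw [hQ', Matrix.one_mul, Matrix.mul_one]
  have e2 : (diagonal (fun i => m (μ i)) * (C * diagonal ν * Cᵀ - diagonal μ)).trace
      = ∑ i, ∑ j, C i j ^ 2 * (m (μ i) * (ν j - μ i)) := by
    rw [trace]
    refine Finset.sum_congr rfl fun i _ => ?_
    rw [diag_apply, diagonal_mul, Matrix.sub_apply, mul_diagonal_mul_transpose_apply, diagonal_apply_eq]
    have : ∑ j, C i j ^ 2 * (m (μ i) * (ν j - μ i))
        = m (μ i) * ∑ j, ν j * (C i j * C i j) - m (μ i) * μ i * ∑ j, C i j ^ 2 := by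
      rw [Finset.mul_sum, Finset.mul_sum, ← Finset.sum_sub_distrib]
      exact Finset.sum_congr rfl fun j _ => by ring
    rw [this, hrow]
    ring
  have e3 : ∑ i, g (ν i) = ∑ i, ∑ j, C i j ^ 2 * g (ν j) := by
    rw [Finset.sum_comm]
    exact Finset.sum_congr rfl fun j _ => by rw [← Finset.sum_mul, hcol, one_mul]
  have e4 : ∑ i, g (μ i) = ∑ i, ∑ j, C i j ^ 2 * g (μ i) :=
    Finset.sum_congr rfl fun j _ => by rw [← Finset.sum_mul, hrow, one_mul]
  rw [e1, e2, e3, e4, ← Finset.sum_sub_distrib]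
  refine Finset.sum_le_sum fun i _ => ?_
  rw [← Finset.sum_sub_distrib]
  refine Finset.sum_le_sum fun j _ => ?_
  rw [← mul_sub]
  exact mul_le_mul_of_nonneg_left (hg _ _) (sq_nonneg _)

end Spectral

/-! ### Convex decomposition of the log-determinant -/

section LogDetShift

open Matrix

variable {k p : ℕ}

/-- The matrix `η I + (1/k) M Mᵀ`. -/
noncomputable def shiftedGram (η : ℝ) (M : Matrix (Fin k) (Fin p) ℝ) : Matrix (Fin k) (Fin k) ℝ :=
  η • (1 : Matrix (Fin k) (Fin k) ℝ) + (1 / (k : ℝ)) • (M * Mᵀ)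

lemma logDetShift_eq_log_det (η : ℝ) (M : Matrix (Fin k) (Fin p) ℝ) :
    logDetShift η M = Real.log (shiftedGram η M).det := rfl

lemma posSemidef_gram (M : Matrix (Fin k) (Fin p) ℝ) :
    ((1 / (k : ℝ)) • (M * Mᵀ)).PosSemidef := by
  have := posSemidef_self_mul_conjTranspose M
  rw [conjTranspose_eq_transpose_of_trivial] at this
  exact this.smul (by positivity)

lemma posDef_shiftedGram {η : ℝ} (hη : 0 < η) (M : Matrix (Fin k) (Fin p) ℝ) :
    (shiftedGram η M).PosDef :=
  (PosDef.one.smul hη).add_posSemidef (posSemidef_gram M)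

/-- The dilation is linear in `M`, so convexity in the symmetric matrix passes to `M`. Its square is
block diagonal with blocks `N Nᵀ` and `Nᵀ N`, whose shifted determinants agree up to a power of `ε`
by Sylvester's identity. -/
lemma log_det_smul_one_add_sq_dilation (hk : 0 < k) {ε : ℝ} (hε : 0 < ε)
    (M : Matrix (Fin k) (Fin p) ℝ) :
    Real.log (ε • (1 : Matrix (Fin k ⊕ Fin p) (Fin k ⊕ Fin p) ℝ)
      + fromBlocks 0 ((1 / √(k : ℝ)) • M) ((1 / √(k : ℝ)) • M)ᵀ 0
        * fromBlocks 0 ((1 / √(k : ℝ)) • M) ((1 / √(k : ℝ)) • M)ᵀ 0).det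
      = 2 * logDetShift ε M + ((p : ℝ) - k) * Real.log ε := by
  have hk' : (0 : ℝ) < k := by exact_mod_cast hk
  set N := (1 / √(k : ℝ)) • M with hN
  have hNN : N * Nᵀ = (1 / (k : ℝ)) • (M * Mᵀ) := by
    rw [hN, transpose_smul, Matrix.smul_mul, Matrix.mul_smul, smul_smul]
    congr 1
    rw [div_mul_div_comm, Real.mul_self_sqrt hk'.le, one_mul]
  have hpos := (posDef_shiftedGram hε M).det_pos
  rw [shiftedGram, ← hNN] at hpos
  have e1 : ε • (1 : Matrix (Fin k ⊕ Fin p) (Fin k ⊕ Fin p) ℝ)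
      + fromBlocks 0 N Nᵀ 0 * fromBlocks 0 N Nᵀ 0
      = fromBlocks (ε • 1 + N * Nᵀ) 0 0 (ε • 1 + Nᵀ * N) := by
    rw [fromBlocks_multiply, ← fromBlocks_one, fromBlocks_smul, fromBlocks_add]
    simp
  have hs : ∀ {m : ℕ} (K : Matrix (Fin m) (Fin m) ℝ),
      (ε • (1 : Matrix (Fin m) (Fin m) ℝ) + K).det = ε ^ m * (1 + ε⁻¹ • K).det := by
    intro m K
    have : ε • (1 : Matrix (Fin m) (Fin m) ℝ) + K = ε • (1 + ε⁻¹ • K) := by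
      rw [smul_add, smul_smul, mul_inv_cancel₀ hε.ne', one_smul]
    rw [this, det_smul, Fintype.card_fin]
  have e2 : (1 + ε⁻¹ • (Nᵀ * N)).det = (1 + ε⁻¹ • (N * Nᵀ)).det := by
    rw [← Matrix.smul_mul, det_one_add_mul_comm, Matrix.mul_smul]
  have hpos2 : 0 < (1 + ε⁻¹ • (N * Nᵀ)).det := by
    rw [hs] at hpos
    exact (pos_iff_pos_of_mul_pos hpos).1 (by positivity)
  rw [e1, det_fromBlocks_zero₁₂, logDetShift, ← hNN, hs, hs, e2,
    Real.log_mul (by positivity) (by positivity), Real.log_mul (by positivity) (by positivity),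
    Real.log_mul (by positivity) (by positivity), Real.log_pow, Real.log_pow]
  ring

/-- `logDetShift ε` is a difference of two convex Lipschitz functions; this is expressed through
their subgradients. -/
lemma exists_logDetShift_sub_le (hk : 0 < k) {ε : ℝ} (hε : 0 < ε) :
    ∃ U V : Matrix (Fin k) (Fin p) ℝ → Matrix (Fin k) (Fin p) ℝ,
      (∀ X, ∑ i, ∑ j, U X i j ^ 2 ≤ 1 / ε) ∧ (∀ X, ∑ i, ∑ j, V X i j ^ 2 ≤ 1 / ε) ∧
      ∀ X Y, logDetShift ε X - logDetShift ε Y ≤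
        ∑ i, ∑ j, (U X i j + V Y i j) * (X i j - Y i j) := by
  have hk' : (0 : ℝ) < k := by exact_mod_cast hk
  obtain ⟨g₁, g₂, m₁, m₂, hg, hm₁, hm₂, hb₁, hb₂⟩ := exists_log_add_sq_eq_sub hε
  set H : Matrix (Fin k) (Fin p) ℝ → Matrix (Fin k ⊕ Fin p) (Fin k ⊕ Fin p) ℝ :=
    fun M => fromBlocks 0 ((1 / √(k : ℝ)) • M) ((1 / √(k : ℝ)) • M)ᵀ 0 with hH
  have hsymm : ∀ M, (H M).IsSymm := fun M => by
    rw [Matrix.IsSymm, hH, fromBlocks_transpose, transpose_transpose]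
    simp
  choose Q μ hQ hQ' hd using fun M => (hsymm M).exists_diagonalization
  set W : (ℝ → ℝ) → Matrix (Fin k) (Fin p) ℝ → Matrix (Fin k ⊕ Fin p) (Fin k ⊕ Fin p) ℝ :=
    fun m M => Q M * diagonal (fun i => m (μ M i)) * (Q M)ᵀ with hW
  have hWsymm : ∀ m M a b, W m M a b = W m M b a := fun m M a b => by
    simp only [hW, mul_diagonal_mul_transpose_apply]
    exact Finset.sum_congr rfl fun i _ => by ring
  have hWsq : ∀ m : ℝ → ℝ, (∀ x, m x ^ 2 ≤ 1 / ε) → ∀ M,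
      ∑ i, ∑ j, (1 / √(k : ℝ) * W m M (Sum.inl i) (Sum.inr j)) ^ 2 ≤ 1 / ε := by
    intro m hm M
    -- Only the `k` rows of the upper-right block enter, and the scaling `1/k` compensates exactly
    -- for their number.
    have h1 : ∀ i, ∑ j, (1 / √(k : ℝ) * W m M (Sum.inl i) (Sum.inr j)) ^ 2
        ≤ 1 / (k : ℝ) * (1 / ε) := by
      intro i
      have := sum_sq_mul_diagonal_mul_transpose_le (hQ M) (hQ' M) (d := fun i => m (μ M i))
        (fun i => hm _) (Sum.inl i)
      rw [Fintype.sum_sum_type] at this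
      have h0 : 0 ≤ ∑ j, W m M (Sum.inl i) (Sum.inl j) ^ 2 :=
        Finset.sum_nonneg fun j _ => sq_nonneg _
      simp only [mul_pow, ← Finset.mul_sum, div_pow, one_pow, Real.sq_sqrt hk'.le]
      refine mul_le_mul_of_nonneg_left ?_ (by positivity)
      simp only [hW] at h0 ⊢
      linarith
    calc _ ≤ ∑ i : Fin k, 1 / (k : ℝ) * (1 / ε) := Finset.sum_le_sum fun i _ => h1 i
      _ = 1 / ε := by
        rw [Finset.sum_const, Finset.card_univ, Fintype.card_fin, nsmul_eq_mul]
        field_simp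
  -- The two off-diagonal blocks contribute equally; this factor `2` cancels the one in front of
  -- `logDetShift`.
  have htrace : ∀ m M X Y, (W m M * (H X - H Y)).trace =
      2 * ∑ i, ∑ j, (1 / √(k : ℝ) * W m M (Sum.inl i) (Sum.inr j)) * (X i j - Y i j) := by
    intro m M X Y
    rw [trace, Fintype.sum_sum_type]
    simp only [diag_apply, Matrix.mul_apply, Fintype.sum_sum_type, hH, Matrix.sub_apply,
      fromBlocks_apply₁₁, fromBlocks_apply₁₂, fromBlocks_apply₂₁, fromBlocks_apply₂₂,
      Matrix.zero_apply, sub_zero, mul_zero, Finset.sum_const_zero, zero_add, add_zero,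
      transpose_apply, Matrix.smul_apply, smul_eq_mul]
    rw [Finset.sum_comm (γ := Fin p), ← Finset.sum_add_distrib, Finset.mul_sum]
    refine Finset.sum_congr rfl fun i _ => ?_
    rw [← Finset.sum_add_distrib, Finset.mul_sum]
    refine Finset.sum_congr rfl fun j _ => ?_
    rw [hWsymm m M (Sum.inr j)]
    ring
  have hlog : ∀ M, 2 * logDetShift ε M + ((p : ℝ) - k) * Real.log ε
      = ∑ i, g₁ (μ M i) - ∑ i, g₂ (μ M i) := by
    intro M
    rw [← log_det_smul_one_add_sq_dilation hk hε]
    change Real.log (ε • (1 : Matrix (Fin k ⊕ Fin p) (Fin k ⊕ Fin p) ℝ) + H M * H M).det = _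
    rw [hd M, det_smul_one_add_sq (hQ M) (hQ' M), Real.log_prod fun i _ => by positivity,
      ← Finset.sum_sub_distrib]
    exact Finset.sum_congr rfl fun i _ => (hg _).symm
  refine ⟨fun M i j => 1 / √(k : ℝ) * W m₁ M (Sum.inl i) (Sum.inr j),
    fun M i j => -(1 / √(k : ℝ) * W m₂ M (Sum.inl i) (Sum.inr j)),
    hWsq m₁ hb₁, fun M => by simpa only [neg_sq] using hWsq m₂ hb₂ M, ?_⟩
  intro X Y
  -- Expanding `g₁` at `X` and `g₂` at `Y` makes one subgradient depend on `X` only and the other on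
  -- `Y` only, as Marton's inequality requires.
  have k1 := klein_inequality (hQ X) (hQ' X) (hQ Y) (hQ' Y) (μ X) (μ Y) hm₁
  have k2 := klein_inequality (hQ Y) (hQ' Y) (hQ X) (hQ' X) (μ Y) (μ X) hm₂
  rw [← hd, ← hd] at k1 k2
  change (W m₁ X * (H Y - H X)).trace ≤ _ at k1
  change (W m₂ Y * (H X - H Y)).trace ≤ _ at k2
  rw [htrace] at k1 k2
  have e : ∑ i, ∑ j, (1 / √(k : ℝ) * W m₁ X (Sum.inl i) (Sum.inr j)
        + -(1 / √(k : ℝ) * W m₂ Y (Sum.inl i) (Sum.inr j))) * (X i j - Y i j)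
      = -(∑ i, ∑ j, (1 / √(k : ℝ) * W m₁ X (Sum.inl i) (Sum.inr j)) * (Y i j - X i j))
        - ∑ i, ∑ j, (1 / √(k : ℝ) * W m₂ Y (Sum.inl i) (Sum.inr j)) * (X i j - Y i j) := by
    rw [← Finset.sum_neg_distrib, ← Finset.sum_sub_distrib]
    refine Finset.sum_congr rfl fun i _ => ?_
    rw [← Finset.sum_neg_distrib, ← Finset.sum_sub_distrib]
    exact Finset.sum_congr rfl fun j _ => by ring
  have l1 := hlog X
  have l2 := hlog Y
  rw [e]
  linarith

end LogDetShift

/-! ### Concavity of `log det`, and the gradient of `logDetShift` -/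

section LogDetGradient

open Matrix

variable {k p : ℕ}

open scoped MatrixOrder in
lemma Matrix.PosSemidef.exists_eq_transpose_mul_self {n : Type*} [Fintype n] {A : Matrix n n ℝ}
    (hA : A.PosSemidef) : ∃ C : Matrix n n ℝ, A = Cᵀ * C := by
  classical
  obtain ⟨C, hC⟩ := CStarAlgebra.nonneg_iff_eq_star_mul_self.1 hA.nonneg
  exact ⟨C, by rw [hC, star_eq_conjTranspose, conjTranspose_eq_transpose_of_trivial]⟩

/-- The tangent inequality for the concave function `log det`. -/
lemma log_det_sub_log_det_le {n : Type*} [Fintype n] [DecidableEq n] {A B : Matrix n n ℝ}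
    (hA : A.PosDef) (hB : B.PosDef) :
    Real.log B.det - Real.log A.det ≤ (A⁻¹ * (B - A)).trace := by
  -- With `A⁻¹ = Cᵀ C` the claim becomes `log det ≤ trace - n` for `C B Cᵀ`, which is `log λ ≤ λ -
  -- 1` summed over eigenvalues.
  obtain ⟨C, hC⟩ := hA.inv.posSemidef.exists_eq_transpose_mul_self
  have hAu : IsUnit A.det := hA.det_pos.ne'.isUnit
  have hD : (C * B * Cᵀ).PosSemidef := by
    have := hB.posSemidef.mul_mul_conjTranspose_same C
    rwa [conjTranspose_eq_transpose_of_trivial] at this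
  have hdet : (C * B * Cᵀ).det = B.det / A.det := by
    have : A⁻¹.det = C.det * C.det := by rw [hC, det_mul, det_transpose]
    rw [det_nonsing_inv, Ring.inverse_eq_inv'] at this
    rw [det_mul, det_mul, det_transpose, div_eq_mul_inv, this]
    ring
  have htr : (A⁻¹ * (B - A)).trace = (C * B * Cᵀ).trace - Fintype.card n := by
    rw [Matrix.mul_sub, nonsing_inv_mul _ hAu, trace_sub, trace_one, hC, Matrix.mul_assoc,
      trace_mul_comm]
  have hpos : ∀ i, 0 < hD.isHermitian.eigenvalues i := by
    intro i
    refine lt_of_le_of_ne (hD.eigenvalues_nonneg i) fun h => ?_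
    have : (C * B * Cᵀ).det = 0 := by
      rw [hD.isHermitian.det_eq_prod_eigenvalues]
      exact Finset.prod_eq_zero (Finset.mem_univ i) (by simp [← h])
    rw [hdet] at this
    exact (div_pos hB.det_pos hA.det_pos).ne' this
  rw [← Real.log_div hB.det_pos.ne' hA.det_pos.ne', ← hdet, htr,
    hD.isHermitian.det_eq_prod_eigenvalues, hD.isHermitian.trace_eq_sum_eigenvalues]
  simp only [RCLike.ofReal_real_eq_id, id_eq]
  rw [Real.log_prod fun i _ => (hpos i).ne']
  calc ∑ i, Real.log (hD.isHermitian.eigenvalues i)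
      ≤ ∑ i, (hD.isHermitian.eigenvalues i - 1) :=
        Finset.sum_le_sum fun i _ => Real.log_le_sub_one_of_pos (hpos i)
    _ = _ := by simp

lemma logDetShift_mono {η η' : ℝ} (hη : 0 < η) (h : η ≤ η') (M : Matrix (Fin k) (Fin p) ℝ) :
    logDetShift η M ≤ logDetShift η' M := by
  have hpd := posDef_shiftedGram (hη.trans_le h) M
  have := log_det_sub_log_det_le hpd (posDef_shiftedGram hη M)
  have e : shiftedGram η M - shiftedGram η' M = (η - η') • (1 : Matrix (Fin k) (Fin k) ℝ) := by
    rw [shiftedGram, shiftedGram, sub_smul]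
    abel
  rw [e, Matrix.mul_smul, Matrix.mul_one, trace_smul, smul_eq_mul] at this
  rw [logDetShift_eq_log_det, logDetShift_eq_log_det]
  nlinarith [hpd.inv.posSemidef.trace_nonneg]

lemma posDef_smul_one {η : ℝ} (hη : 0 < η) : (η • (1 : Matrix (Fin k) (Fin k) ℝ)).PosDef :=
  PosDef.one.smul hη

lemma log_det_smul_one (η : ℝ) :
    Real.log (η • (1 : Matrix (Fin k) (Fin k) ℝ)).det = k * Real.log η := by
  simp [Real.log_pow]

/-- Tangent inequality at `η I`. With the matching lower bound it makes second moments of the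
entries enough for integrability. -/
lemma logDetShift_le {η : ℝ} (hη : 0 < η) (M : Matrix (Fin k) (Fin p) ℝ) :
    logDetShift η M ≤ k * Real.log η + η⁻¹ * (1 / k * ∑ i, ∑ j, M i j ^ 2) := by
  have := log_det_sub_log_det_le (posDef_smul_one hη) (posDef_shiftedGram hη M)
  have e1 : (η • (1 : Matrix (Fin k) (Fin k) ℝ))⁻¹ = η⁻¹ • (1 : Matrix (Fin k) (Fin k) ℝ) := by
    refine inv_eq_left_inv ?_
    rw [smul_mul_smul_comm, inv_mul_cancel₀ hη.ne', one_smul, Matrix.one_mul]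
  have e2 : (M * Mᵀ).trace = ∑ i, ∑ j, M i j ^ 2 := by
    rw [trace]
    refine Finset.sum_congr rfl fun i _ => ?_
    rw [diag_apply, Matrix.mul_apply]
    exact Finset.sum_congr rfl fun j _ => by rw [transpose_apply, sq]
  rw [log_det_smul_one, shiftedGram, add_sub_cancel_left, e1, Matrix.smul_mul, Matrix.one_mul,
    trace_smul, trace_smul, e2, smul_eq_mul, smul_eq_mul] at this
  rw [logDetShift_eq_log_det, shiftedGram]
  linarith

lemma le_logDetShift {η : ℝ} (hη : 0 < η) (M : Matrix (Fin k) (Fin p) ℝ) :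
    k * Real.log η ≤ logDetShift η M := by
  have hpd := posDef_shiftedGram hη M
  have := log_det_sub_log_det_le hpd (posDef_smul_one hη)
  obtain ⟨C, hC⟩ := hpd.inv.posSemidef.exists_eq_transpose_mul_self
  have h1 := ((posSemidef_gram M).mul_mul_conjTranspose_same C).trace_nonneg
  rw [conjTranspose_eq_transpose_of_trivial] at h1
  have e : η • (1 : Matrix (Fin k) (Fin k) ℝ) - shiftedGram η M
      = -((1 / (k : ℝ)) • (M * Mᵀ)) := by
    rw [shiftedGram]
    abel
  rw [e, hC, Matrix.mul_neg, trace_neg, Matrix.mul_assoc, trace_mul_comm, log_det_smul_one] at this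
  rw [logDetShift_eq_log_det]
  linarith

lemma continuous_shiftedGram (η : ℝ) :
    Continuous fun M : Matrix (Fin k) (Fin p) ℝ => shiftedGram η M := by
  unfold shiftedGram
  fun_prop

lemma continuous_logDetShift {η : ℝ} (hη : 0 < η) :
    Continuous fun M : Matrix (Fin k) (Fin p) ℝ => logDetShift η M :=
  (continuous_shiftedGram η).matrix_det.log fun M => (posDef_shiftedGram hη M).det_pos.ne'

/-- The gradient of `logDetShift η`. -/
noncomputable def logDetShiftGrad (η : ℝ) (M : Matrix (Fin k) (Fin p) ℝ) :
    Matrix (Fin k) (Fin p) ℝ :=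
  (2 / (k : ℝ)) • ((shiftedGram η M)⁻¹ * M)

lemma continuous_logDetShiftGrad {η : ℝ} (hη : 0 < η) :
    Continuous fun M : Matrix (Fin k) (Fin p) ℝ => logDetShiftGrad η M := by
  have h : Continuous fun M : Matrix (Fin k) (Fin p) ℝ => (shiftedGram η M)⁻¹ := by
    have : (fun M : Matrix (Fin k) (Fin p) ℝ => (shiftedGram η M)⁻¹)
        = fun M => (shiftedGram η M).det⁻¹ • (shiftedGram η M).adjugate := by
      funext M
      rw [inv_def, Ring.inverse_eq_inv']
    rw [this]
    exact ((continuous_shiftedGram η).matrix_det.inv₀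
      fun M => (posDef_shiftedGram hη M).det_pos.ne').smul (continuous_shiftedGram η).matrix_adjugate
  unfold logDetShiftGrad
  exact (h.matrix_mul continuous_id).const_smul (2 / (k : ℝ))

lemma transpose_inv_shiftedGram {η : ℝ} (hη : 0 < η) (M : Matrix (Fin k) (Fin p) ℝ) :
    ((shiftedGram η M)⁻¹)ᵀ = (shiftedGram η M)⁻¹ := by
  have := (posDef_shiftedGram hη M).inv.isHermitian
  rwa [Matrix.IsHermitian, conjTranspose_eq_transpose_of_trivial] at this

/-- With `S` the inverse of the shifted Gram matrix, the sum is `(4/k) tr(S - η S²)`, and `(2ηS -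
1)² ≥ 0` gives `4η(S - η S²) ≤ 1`, whose trace is at most `k`. -/
lemma sum_sq_logDetShiftGrad_le (hk : 0 < k) {η : ℝ} (hη : 0 < η) (M : Matrix (Fin k) (Fin p) ℝ) :
    ∑ i, ∑ j, logDetShiftGrad η M i j ^ 2 ≤ 1 / η := by
  have hk' : (0 : ℝ) < k := by exact_mod_cast hk
  have hpd := posDef_shiftedGram hη M
  have hST := transpose_inv_shiftedGram hη M
  set B := shiftedGram η M with hB
  set S := B⁻¹ with hS
  have hSB : S * B = 1 := nonsing_inv_mul _ hpd.det_pos.ne'.isUnit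
  have e1 : ∑ i, ∑ j, logDetShiftGrad η M i j ^ 2
      = (logDetShiftGrad η M * (logDetShiftGrad η M)ᵀ).trace := by
    rw [trace]
    refine Finset.sum_congr rfl fun i _ => ?_
    rw [diag_apply, Matrix.mul_apply]
    exact Finset.sum_congr rfl fun j _ => by rw [transpose_apply, sq]
  have hMM : M * Mᵀ = (k : ℝ) • (B - η • 1) := by
    rw [hB, shiftedGram, add_sub_cancel_left, smul_smul, mul_one_div_cancel hk'.ne', one_smul]
  have e2 : logDetShiftGrad η M * (logDetShiftGrad η M)ᵀ = (4 / (k : ℝ)) • (S - η • (S * S)) := by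
    rw [logDetShiftGrad, ← hB, ← hS, transpose_smul, transpose_mul, hST, Matrix.smul_mul,
      Matrix.mul_smul, smul_smul]
    have : S * M * (Mᵀ * S) = (k : ℝ) • (S - η • (S * S)) := by
      calc S * M * (Mᵀ * S) = S * (M * Mᵀ) * S := by simp only [Matrix.mul_assoc]
        _ = _ := by
          rw [hMM, Matrix.mul_smul, Matrix.smul_mul, Matrix.mul_sub, hSB, Matrix.sub_mul,
            Matrix.one_mul, Matrix.mul_smul, Matrix.mul_one, Matrix.smul_mul]
    rw [this, smul_smul]
    congr 1
    field_simp
    norm_num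
  have h0 : 0 ≤ (((2 * η) • S - 1) * ((2 * η) • S - 1)ᵀ).trace := by
    have := (posSemidef_self_mul_conjTranspose ((2 * η) • S - 1)).trace_nonneg
    rwa [conjTranspose_eq_transpose_of_trivial] at this
  have e3 : ((2 * η) • S - 1) * ((2 * η) • S - 1)ᵀ = 1 - (4 * η) • (S - η • (S * S)) := by
    rw [transpose_sub, transpose_smul, hST, transpose_one, Matrix.sub_mul, Matrix.mul_sub,
      Matrix.one_mul, Matrix.mul_one, Matrix.smul_mul, Matrix.mul_smul]
    module
  rw [e3, trace_sub, trace_one, trace_smul, Fintype.card_fin, smul_eq_mul] at h0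
  rw [e1, e2, trace_smul, smul_eq_mul]
  have : 4 / (k : ℝ) * (S - η • (S * S)).trace = (4 * η * (S - η • (S * S)).trace) / (k * η) := by
    field_simp
  rw [this, div_le_div_iff₀ (by positivity) hη]
  nlinarith

/-- Differentiability holds because the determinant is polynomial in `t` and positive. The value
needs no derivative formula: concavity of `log det` supplies a quadratic majorant touching at `t =
0`, and the gap, minimal there, has zero derivative. -/
lemma hasDerivAt_logDetShift {η : ℝ} (hη : 0 < η) (M : Matrix (Fin k) (Fin p) ℝ) (i : Fin k)
    (j : Fin p) :
    HasDerivAt (fun t : ℝ => logDetShift η (M + t • Matrix.single i j 1))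
      (logDetShiftGrad η M i j) 0 := by
  have hpd := posDef_shiftedGram hη M
  have hST := transpose_inv_shiftedGram hη M
  set E : Matrix (Fin k) (Fin p) ℝ := Matrix.single i j 1 with hE
  set S := (shiftedGram η M)⁻¹ with hS
  have hdiff : DifferentiableAt ℝ (fun t : ℝ => logDetShift η (M + t • E)) 0 := by
    refine DifferentiableAt.log ?_ (posDef_shiftedGram hη _).det_pos.ne'
    simp only [det_apply, Matrix.add_apply, Matrix.smul_apply, Matrix.mul_apply, transpose_apply]
    fun_prop
  have hbound : ∀ t : ℝ, logDetShift η (M + t • E) - logDetShift η M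
      ≤ t * logDetShiftGrad η M i j + t ^ 2 * (1 / (k : ℝ) * (S * (E * Eᵀ)).trace) := by
    intro t
    have := log_det_sub_log_det_le hpd (posDef_shiftedGram hη (M + t • E))
    have e1 : shiftedGram η (M + t • E) - shiftedGram η M
        = (1 / (k : ℝ)) • (t • (E * Mᵀ) + t • (M * Eᵀ) + t ^ 2 • (E * Eᵀ)) := by
      rw [shiftedGram, shiftedGram, add_sub_add_left_eq_sub, ← smul_sub]
      congr 1
      rw [transpose_add, transpose_smul, Matrix.add_mul, Matrix.mul_add, Matrix.mul_add,
        Matrix.smul_mul, Matrix.smul_mul, Matrix.mul_smul, Matrix.mul_smul, smul_smul, sq]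
      abel
    have e2 : (S * (M * Eᵀ)).trace = (S * M) i j := by
      rw [← Matrix.mul_assoc, hE, transpose_single, trace_mul_comm, trace_single_mul]
      simp
    have e3 : (S * (E * Mᵀ)).trace = (S * M) i j := by
      rw [← e2, ← trace_transpose, transpose_mul, transpose_mul, transpose_transpose, hST,
        trace_mul_comm]
    rw [e1, ← hS, Matrix.mul_smul, trace_smul, Matrix.mul_add, Matrix.mul_add, trace_add,
      trace_add, Matrix.mul_smul, Matrix.mul_smul, Matrix.mul_smul, trace_smul, trace_smul,
      trace_smul, e2, e3] at this
    simp only [smul_eq_mul] at this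
    rw [logDetShift_eq_log_det, logDetShift_eq_log_det]
    refine this.trans_eq ?_
    rw [logDetShiftGrad, Matrix.smul_apply, smul_eq_mul, ← hS]
    ring
  set c := 1 / (k : ℝ) * (S * (E * Eᵀ)).trace with hc
  have hmin : IsLocalMin (fun t : ℝ => t * logDetShiftGrad η M i j + t ^ 2 * c
      - logDetShift η (M + t • E)) 0 := by
    refine Filter.Eventually.of_forall fun t => ?_
    have := hbound t
    simp only [zero_mul, zero_smul, add_zero]
    norm_num
    linarith
  have hd : HasDerivAt (fun t : ℝ => t * logDetShiftGrad η M i j + t ^ 2 * c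
      - logDetShift η (M + t • E)) (logDetShiftGrad η M i j
        - deriv (fun t : ℝ => logDetShift η (M + t • E)) 0) 0 := by
    have h1 := (hasDerivAt_id (0 : ℝ)).mul_const (logDetShiftGrad η M i j)
    have h2 := (hasDerivAt_pow 2 (0 : ℝ)).mul_const c
    exact ((h1.add h2).sub hdiff.hasDerivAt).congr_deriv (by simp)
  have h0 := hmin.hasDerivAt_eq_zero hd
  rw [sub_eq_zero.1 h0]
  exact hdiff.hasDerivAt

end LogDetGradient

/-! ### Sub-Gaussian moments for bounded independent variables -/

section Concentration

open Filter Topology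

variable {Ω : Type*} [MeasurableSpace Ω] {P : Measure Ω} [IsProbabilityMeasure P]

lemma integral_comp_eq_sum_of_iIndepFun {α : Type*} [Fintype α] [MeasurableSpace α]
    [MeasurableSingletonClass α] {n : ℕ} {Z : Fin n → Ω → α} (hZ : ∀ i, Measurable (Z i))
    (hindep : iIndepFun Z P) (G : (Fin n → α) → ℝ) :
    ∫ ω, G (fun i => Z i ω) ∂P = ∑ x : Fin n → α, (∏ i, P.real (Z i ⁻¹' {x i})) * G x := by
  have hm : Measurable fun ω i => Z i ω := measurable_pi_lambda _ hZ
  have : ∀ i, IsProbabilityMeasure (P.map (Z i)) :=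
    fun i => Measure.isProbabilityMeasure_map (hZ i).aemeasurable
  rw [← integral_map (φ := fun ω i => Z i ω) (f := G) hm.aemeasurable
      (measurable_of_finite G).aestronglyMeasurable,
    (iIndepFun_iff_map_fun_eq_pi_map fun i => (hZ i).aemeasurable).1 hindep,
    integral_fintype Integrable.of_finite]
  refine Finset.sum_congr rfl fun x _ => ?_
  rw [smul_eq_mul, Measure.real, Measure.pi_singleton, ENNReal.toReal_prod]
  congr 1
  refine Finset.prod_congr rfl fun i _ => ?_
  rw [Measure.map_apply (hZ i) (measurableSet_singleton _), Measure.real]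

/-- Gaussian bound on the exponential moments of a difference of two convex Lipschitz functions
of independent random variables with finitely many values in `[-D, D]`. -/
lemma integral_exp_le_of_simpleFunc {n : ℕ} {X : Fin n → Ω → ℝ} (hX : ∀ i, Measurable (X i))
    (hindep : iIndepFun X P) {D K t : ℝ} (ht : 0 ≤ t) {F : (Fin n → ℝ) → ℝ}
    {U V : (Fin n → ℝ) → Fin n → ℝ} (hU : ∀ x, ∑ i, U x i ^ 2 ≤ K) (hV : ∀ x, ∑ i, V x i ^ 2 ≤ K)
    (hF : ∀ x y, F x - F y ≤ ∑ i, (U x i + V y i) * (x i - y i))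
    (f : SimpleFunc ℝ ℝ) (hf : ∀ x, f x ∈ Set.Icc (-D) D) :
    ∫ ω, Real.exp (t * F (fun i => f (X i ω))) ∂P
      ≤ Real.exp (t * ∫ ω, F (fun i => f (X i ω)) ∂P + 8 * D ^ 2 * K * t ^ 2 / 2) := by
  classical
  have hD : 0 ≤ D := by
    have := hf 0
    linarith [this.1, this.2]
  -- Viewed in the finite type `f.range`, the discretized variables stay independent and the
  -- finite-alphabet inequality applies.
  let f' : ℝ → f.range := fun x => ⟨f x, f.mem_range_self x⟩
  have hfm : Measurable f' := f.measurable.subtype_mk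
  let Z : Fin n → Ω → f.range := fun i ω => f' (X i ω)
  have hZ : ∀ i, Measurable (Z i) := fun i => hfm.comp (hX i)
  have hZi : iIndepFun Z P := hindep.comp (fun _ => f') fun _ => hfm
  have hrange : ∀ s : f.range, (s : ℝ) ∈ Set.Icc (-D) D := by
    rintro ⟨s, hs⟩
    obtain ⟨x, rfl⟩ := SimpleFunc.mem_range.1 hs
    exact hf x
  set w : Fin n → f.range → ℝ := fun i s => P.real (Z i ⁻¹' {s}) with hw
  have hw1 : ∀ i, ∑ s, w i s = 1 := fun i => by
    have : IsProbabilityMeasure (P.map (Z i)) :=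
      Measure.isProbabilityMeasure_map (hZ i).aemeasurable
    have h := integral_fintype (μ := P.map (Z i)) (f := fun _ => (1 : ℝ)) Integrable.of_finite
    simp only [integral_const, probReal_univ, smul_eq_mul, mul_one] at h
    rw [h]
    refine Finset.sum_congr rfl fun s _ => ?_
    simp only [hw, measureReal_def, Measure.map_apply (hZ i) (measurableSet_singleton _)]
  have hwprod : ∑ x : Fin n → f.range, ∏ i, w i (x i) = 1 := by
    have h := integral_comp_eq_sum_of_iIndepFun hZ hZi (fun _ => (1 : ℝ))
    simpa using h.symm
  -- Distinct values differ by at most `2D`, hence the costs `2Dt|U i|` and `2Dt|V i|`. Each family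
  -- has half its sum of squares at most `2D²Kt²`, and the two together give `v = 8D²K`.
  have key := sum_prod_mul_exp_le w (fun i s => measureReal_nonneg) hw1
    (fun x => t * F (fun i => x i)) (fun x => t * F (fun i => x i))
    (fun i x => t * (2 * D * |U (fun i => x i) i|)) (fun i x => t * (2 * D * |V (fun i => x i) i|))
    (fun i x => by positivity) (fun i x => by positivity)
    (by
      intro x y
      rw [← mul_sub]
      refine (mul_le_mul_of_nonneg_left (hF _ _) ht).trans ?_
      rw [Finset.mul_sum]
      refine Finset.sum_le_sum fun i _ => ?_
      split_ifs with h
      · rw [h]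
        simp
      · have h1 := hrange (x i)
        have h2 := hrange (y i)
        have h3 : |(x i : ℝ) - y i| ≤ 2 * D := by
          rw [abs_le]
          constructor <;> linarith [h1.1, h1.2, h2.1, h2.2]
        rw [← mul_add, ← mul_add]
        refine mul_le_mul_of_nonneg_left ?_ ht
        refine (le_abs_self _).trans ?_
        rw [abs_mul, mul_comm]
        exact mul_le_mul h3 (abs_add_le _ _) (abs_nonneg _) (by positivity))
  have hsq : ∀ W : (Fin n → ℝ) → Fin n → ℝ, (∀ x, ∑ i, W x i ^ 2 ≤ K) → ∀ x,
      ∑ i, (t * (2 * D * |W x i|)) ^ 2 / 2 ≤ 2 * D ^ 2 * K * t ^ 2 := by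
    intro W hW x
    calc ∑ i, (t * (2 * D * |W x i|)) ^ 2 / 2 = 2 * D ^ 2 * t ^ 2 * ∑ i, W x i ^ 2 := by
          rw [Finset.mul_sum]
          refine Finset.sum_congr rfl fun i _ => ?_
          rw [mul_pow, mul_pow, sq_abs]
          ring
      _ ≤ 2 * D ^ 2 * t ^ 2 * K := by
          gcongr
          exact hW x
      _ = _ := by ring
  have e1 := integral_comp_eq_sum_of_iIndepFun hZ hZi
    (fun x => Real.exp (t * F (fun i => x i)))
  have e2 := integral_comp_eq_sum_of_iIndepFun hZ hZi (fun x => F (fun i => x i))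
  change ∫ ω, Real.exp (t * F (fun i => f (X i ω))) ∂P = _ at e1
  change ∫ ω, F (fun i => f (X i ω)) ∂P = _ at e2
  have hprod0 : ∀ x : Fin n → f.range, 0 ≤ ∏ i, w i (x i) :=
    fun x => Finset.prod_nonneg fun i _ => measureReal_nonneg
  rw [e1, e2]
  have l1 : (∑ x : Fin n → f.range, (∏ i, w i (x i)) * Real.exp (t * F (fun i => x i)))
      * Real.exp (-(2 * D ^ 2 * K * t ^ 2))
      ≤ ∑ x : Fin n → f.range, (∏ i, w i (x i)) * Real.exp (t * F (fun i => x i)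
        - ∑ i, (t * (2 * D * |U (fun i => x i) i|)) ^ 2 / 2) := by
    rw [Finset.sum_mul]
    refine Finset.sum_le_sum fun x _ => ?_
    rw [mul_assoc, ← Real.exp_add]
    refine mul_le_mul_of_nonneg_left (Real.exp_le_exp.2 ?_) (hprod0 x)
    linarith [hsq U hU (fun i => x i)]
  have l2 : ∑ x : Fin n → f.range, (∏ i, w i (x i)) * (t * F (fun i => x i)
        + ∑ i, (t * (2 * D * |V (fun i => x i) i|)) ^ 2 / 2)
      ≤ t * (∑ x : Fin n → f.range, (∏ i, w i (x i)) * F (fun i => x i))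
        + 2 * D ^ 2 * K * t ^ 2 := by
    calc _ ≤ ∑ x : Fin n → f.range, (∏ i, w i (x i)) * (t * F (fun i => x i)
          + 2 * D ^ 2 * K * t ^ 2) := by
          refine Finset.sum_le_sum fun x _ => mul_le_mul_of_nonneg_left ?_ (hprod0 x)
          linarith [hsq V hV (fun i => x i)]
      _ = _ := by
          simp only [mul_add, Finset.sum_add_distrib, ← Finset.sum_mul, hwprod, one_mul,
            Finset.mul_sum]
          congr 1
          exact Finset.sum_congr rfl fun x _ => by ring
  have l3 := (l1.trans key).trans (Real.exp_le_exp.2 l2)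
  rw [Real.exp_neg, ← div_eq_mul_inv, div_le_iff₀ (Real.exp_pos _), ← Real.exp_add] at l3
  refine l3.trans_eq ?_
  congr 1
  ring

/-- Gaussian bound on the exponential moments of a difference of two convex Lipschitz functions
of bounded independent random variables. -/
theorem integral_exp_le_of_bounded {ι : Type*} [Fintype ι] {X : ι → Ω → ℝ}
    (hX : ∀ i, Measurable (X i)) (hindep : iIndepFun X P) {D K t : ℝ} (hD : 0 ≤ D) (ht : 0 ≤ t)
    (hXD : ∀ i, ∀ᵐ ω ∂P, |X i ω| ≤ D) {F : (ι → ℝ) → ℝ} (hFc : Continuous F)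
    {U V : (ι → ℝ) → ι → ℝ} (hU : ∀ x, ∑ i, U x i ^ 2 ≤ K) (hV : ∀ x, ∑ i, V x i ^ 2 ≤ K)
    (hF : ∀ x y, F x - F y ≤ ∑ i, (U x i + V y i) * (x i - y i)) :
    Integrable (fun ω => Real.exp (t * F (fun i => X i ω))) P ∧
    ∫ ω, Real.exp (t * F (fun i => X i ω)) ∂P
      ≤ Real.exp (t * ∫ ω, F (fun i => X i ω) ∂P + 8 * D ^ 2 * K * t ^ 2 / 2) := by
  have h0 : (0 : ℝ) ∈ Set.Icc (-D) D := by simp [hD]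
  -- Approximating inside `[-D, D]` keeps every argument in a compact cube on which `F` is bounded,
  -- so dominated convergence applies.
  set f : ℕ → SimpleFunc ℝ ℝ := fun m =>
    SimpleFunc.approxOn id measurable_id (Set.Icc (-D) D) 0 h0 m with hf
  have hfmem : ∀ m x, f m x ∈ Set.Icc (-D) D := fun m x => SimpleFunc.approxOn_mem _ _ m x
  obtain ⟨C, hC⟩ := (isCompact_univ_pi fun _ : ι => isCompact_Icc (a := -D) (b := D)).exists_bound_of_continuousOn
    hFc.continuousOn
  have hXmem : ∀ᵐ ω ∂P, ∀ i, X i ω ∈ Set.Icc (-D) D := by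
    rw [ae_all_iff]
    intro i
    filter_upwards [hXD i] with ω hω using abs_le.1 hω
  have hlim : ∀ᵐ ω ∂P, Tendsto (fun m => F (fun i => f m (X i ω))) atTop
      (𝓝 (F (fun i => X i ω))) := by
    filter_upwards [hXmem] with ω hω
    refine (hFc.tendsto _).comp (tendsto_pi_nhds.2 fun i => ?_)
    exact SimpleFunc.tendsto_approxOn measurable_id h0 (subset_closure (hω i))
  have hbound : ∀ m ω, |F (fun i => f m (X i ω))| ≤ C := fun m ω =>
    hC _ fun i _ => hfmem m _
  have hmeas : ∀ m, Measurable fun ω => F (fun i => f m (X i ω)) := fun m =>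
    hFc.measurable.comp (measurable_pi_lambda _ fun i => (f m).measurable.comp (hX i))
  have hexpb : ∀ a : ℝ, |a| ≤ C → ‖Real.exp (t * a)‖ ≤ Real.exp (t * C) := fun a ha => by
    rw [Real.norm_eq_abs, Real.abs_exp]
    gcongr
    exact (le_abs_self a).trans ha
  have hint : Integrable (fun ω => Real.exp (t * F (fun i => X i ω))) P := by
    refine Integrable.of_bound ?_ (Real.exp (t * C)) ?_
    · exact (((hFc.measurable.comp (measurable_pi_lambda _ hX)).const_mul t).exp).aestronglyMeasurable
    · filter_upwards [hXmem] with ω hω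
      exact hexpb _ (hC _ fun i _ => hω i)
  refine ⟨hint, ?_⟩
  have t1 : Tendsto (fun m => ∫ ω, Real.exp (t * F (fun i => f m (X i ω))) ∂P) atTop
      (𝓝 (∫ ω, Real.exp (t * F (fun i => X i ω)) ∂P)) := by
    refine tendsto_integral_of_dominated_convergence (fun _ => Real.exp (t * C))
      (fun m => ((hmeas m).const_mul t).exp.aestronglyMeasurable) (integrable_const _)
      (fun m => Eventually.of_forall fun ω => hexpb _ (hbound m ω)) ?_
    filter_upwards [hlim] with ω hω
    exact (Real.continuous_exp.tendsto _).comp (hω.const_mul t)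
  have t2 : Tendsto (fun m => ∫ ω, F (fun i => f m (X i ω)) ∂P) atTop
      (𝓝 (∫ ω, F (fun i => X i ω) ∂P)) :=
    tendsto_integral_of_dominated_convergence (fun _ => C)
      (fun m => (hmeas m).aestronglyMeasurable) (integrable_const _)
      (fun m => Eventually.of_forall fun ω => hbound m ω) hlim
  refine le_of_tendsto_of_tendsto' t1
    ((Real.continuous_exp.tendsto _).comp ((t2.const_mul t).add_const _)) fun m => ?_
  let e := Fintype.equivFin ι
  have hsum : ∀ g : ι → ℝ, ∑ i, g (e.symm i) = ∑ i, g i := fun g => e.symm.sum_comp g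
  have := integral_exp_le_of_simpleFunc (P := P) (X := fun i => X (e.symm i))
    (fun i => hX _) (hindep.precomp e.symm.injective) (D := D) (K := K) ht
    (F := fun x => F (fun i => x (e i))) (U := fun x i => U (fun i => x (e i)) (e.symm i))
    (V := fun x i => V (fun i => x (e i)) (e.symm i))
    (fun x => by rw [hsum fun i => U (fun i => x (e i)) i ^ 2]; exact hU _)
    (fun x => by rw [hsum fun i => V (fun i => x (e i)) i ^ 2]; exact hV _)
    (fun x y => by
      refine (hF _ _).trans_eq ?_
      rw [← hsum]
      simp) (f m) (hfmem m)
  simpa using this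

/-- Chernoff's bound for sub-Gaussian exponential moments. -/
lemma measureReal_ge_le_of_integral_exp_le {Y : Ω → ℝ} {v δ : ℝ} (hv : 0 < v) (hδ : 0 ≤ δ)
    (h : ∀ t : ℝ, 0 ≤ t → Integrable (fun ω => Real.exp (t * Y ω)) P ∧
      ∫ ω, Real.exp (t * Y ω) ∂P ≤ Real.exp (t * ∫ ω, Y ω ∂P + v * t ^ 2 / 2)) :
    P.real {ω | (∫ ω', Y ω' ∂P) + δ ≤ Y ω} ≤ Real.exp (-(δ ^ 2 / (2 * v))) := by
  have ht : 0 ≤ δ / v := by positivity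
  obtain ⟨h1, h2⟩ := h (δ / v) ht
  refine (measure_ge_le_exp_mul_mgf _ ht h1).trans ?_
  refine (mul_le_mul_of_nonneg_left h2 (Real.exp_pos _).le).trans ?_
  rw [← Real.exp_add, Real.exp_le_exp]
  apply le_of_eq
  field_simp
  ring

end Concentration

/-! ### Entropy, its tensorization, and the LSI for exponentials -/

section Entropy

open Filter Topology

/-- The entropy `∫ f log f - (∫ f) log (∫ f)` of a positive function. -/
noncomputable def entropyFun {α : Type*} [MeasurableSpace α] (μ : Measure α) (f : α → ℝ) : ℝ :=
  ∫ x, f x * Real.log (f x) ∂μ - (∫ x, f x ∂μ) * Real.log (∫ x, f x ∂μ)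

lemma exists_abs_log_le {m M : ℝ} (hm : 0 < m) : ∃ C, 0 ≤ C ∧ ∀ t ∈ Set.Icc m M, |Real.log t| ≤ C := by
  obtain ⟨C, hC⟩ := (isCompact_Icc (a := m) (b := M)).exists_bound_of_continuousOn
    (Real.continuousOn_log.mono fun t ht => (hm.trans_le ht.1).ne')
  exact ⟨max C 0, le_max_right _ _, fun t ht => (hC t ht).trans (le_max_left _ _)⟩

section

variable {α β : Type*} [MeasurableSpace α] [MeasurableSpace β] {μ : Measure α} {ν : Measure β}
  [IsProbabilityMeasure μ] [IsProbabilityMeasure ν] {m M : ℝ}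

lemma integrable_of_mem_Icc {f : α → ℝ} (hf : Measurable f) (h : ∀ x, f x ∈ Set.Icc m M) :
    Integrable f μ := by
  refine Integrable.of_bound hf.aestronglyMeasurable (max |m| |M|)
    (Eventually.of_forall fun x => abs_le_max_abs_abs (h x).1 (h x).2)

lemma integral_mem_Icc {f : α → ℝ} (hf : Measurable f) (h : ∀ x, f x ∈ Set.Icc m M) :
    ∫ x, f x ∂μ ∈ Set.Icc m M := by
  have hi := integrable_of_mem_Icc (μ := μ) hf h
  constructor
  · simpa using integral_mono (integrable_const m) hi fun x => (h x).1
  · simpa using integral_mono hi (integrable_const M) fun x => (h x).2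

lemma integrable_mul_log_of_mem_Icc (hm : 0 < m) {f g : α → ℝ} (hf : Measurable f)
    (h : ∀ x, f x ∈ Set.Icc m M) (hg : Measurable g) (hg' : ∀ x, g x ∈ Set.Icc m M) :
    Integrable (fun x => f x * Real.log (g x)) μ := by
  obtain ⟨C, -, hC⟩ := exists_abs_log_le (M := M) hm
  exact (integrable_of_mem_Icc hf h).mul_bdd (c := C) hg.log.aestronglyMeasurable
    (Eventually.of_forall fun x => hC _ (hg' x))

lemma measurable_integral_snd {f : α × β → ℝ} (hf : Measurable f) :
    Measurable fun x => ∫ y, f (x, y) ∂ν :=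
  (hf.stronglyMeasurable.integral_prod_right' (ν := ν)).measurable

lemma measurable_integral_fst {f : α × β → ℝ} (hf : Measurable f) :
    Measurable fun y => ∫ x, f (x, y) ∂μ :=
  (hf.stronglyMeasurable.integral_prod_left' (μ := μ)).measurable

lemma integrable_entropyFun_snd (hm : 0 < m) {f : α × β → ℝ} (hf : Measurable f)
    (h : ∀ z, f z ∈ Set.Icc m M) : Integrable (fun x => entropyFun ν fun y => f (x, y)) μ := by
  have h1 : Integrable (fun x => ∫ y, f (x, y) * Real.log (f (x, y)) ∂ν) μ :=
    (integrable_mul_log_of_mem_Icc (μ := μ.prod ν) hm hf h hf h).integral_prod_left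
  refine h1.sub (integrable_mul_log_of_mem_Icc hm (m := m) (M := M) ?_ ?_ ?_ ?_)
  · exact measurable_integral_snd hf
  · exact fun x => integral_mem_Icc (hf.comp measurable_prodMk_left) fun y => h _
  · exact measurable_integral_snd hf
  · exact fun x => integral_mem_Icc (hf.comp measurable_prodMk_left) fun y => h _

/-- Subadditivity of entropy on a product of two spaces. -/
lemma entropyFun_prod_le (hm : 0 < m) {f : α × β → ℝ} (hf : Measurable f)
    (h : ∀ z, f z ∈ Set.Icc m M) :
    entropyFun (μ.prod ν) f ≤ ∫ y, entropyFun μ (fun x => f (x, y)) ∂ν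
      + ∫ x, entropyFun ν (fun y => f (x, y)) ∂μ := by
  set f₁ : α → ℝ := fun x => ∫ y, f (x, y) ∂ν with hf₁
  set f₂ : β → ℝ := fun y => ∫ x, f (x, y) ∂μ with hf₂
  set c := ∫ z, f z ∂(μ.prod ν) with hc
  have m₁ : Measurable f₁ := measurable_integral_snd hf
  have m₂ : Measurable f₂ := measurable_integral_fst hf
  have b₁ : ∀ x, f₁ x ∈ Set.Icc m M := fun x =>
    integral_mem_Icc (hf.comp measurable_prodMk_left) fun y => h _
  have b₂ : ∀ y, f₂ y ∈ Set.Icc m M := fun y =>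
    integral_mem_Icc (hf.comp measurable_prodMk_right) fun y => h _
  have bc : c ∈ Set.Icc m M := integral_mem_Icc hf h
  have hcpos : 0 < c := hm.trans_le bc.1
  have hfi := integrable_of_mem_Icc (μ := μ.prod ν) hf h
  have i0 := integrable_mul_log_of_mem_Icc (μ := μ.prod ν) hm hf h hf h
  have i1 : Integrable (fun z : α × β => f z * Real.log (f₁ z.1)) (μ.prod ν) :=
    integrable_mul_log_of_mem_Icc hm hf h (m₁.comp measurable_fst) fun z => b₁ _
  have i2 : Integrable (fun z : α × β => f z * Real.log (f₂ z.2)) (μ.prod ν) :=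
    integrable_mul_log_of_mem_Icc hm hf h (m₂.comp measurable_snd) fun z => b₂ _
  have i12 : Integrable (fun z : α × β => f₁ z.1 * f₂ z.2) (μ.prod ν) :=
    (integrable_of_mem_Icc m₁ b₁).mul_prod (integrable_of_mem_Icc m₂ b₂)
  have ec1 : ∫ x, f₁ x ∂μ = c := (integral_prod f hfi).symm
  have ec2 : ∫ y, f₂ y ∂ν = c := (integral_prod_symm f hfi).symm
  have e1 : ∫ z, f z * Real.log (f₁ z.1) ∂(μ.prod ν) = ∫ x, f₁ x * Real.log (f₁ x) ∂μ := by
    rw [integral_prod _ i1]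
    simp only [integral_mul_const, hf₁]
  have e2 : ∫ z, f z * Real.log (f₂ z.2) ∂(μ.prod ν) = ∫ y, f₂ y * Real.log (f₂ y) ∂ν := by
    rw [integral_prod_symm _ i2]
    simp only [integral_mul_const, hf₂]
  have e12 : ∫ z : α × β, f₁ z.1 * f₂ z.2 ∂(μ.prod ν) = c * c := by
    rw [integral_prod_mul, ec1, ec2]
  -- Nonnegativity of the relative entropy of `f` with respect to `f₁ f₂ / c`, which has the same
  -- total mass `c`; pointwise it is `log x ≤ x - 1`.
  have key : 0 ≤ ∫ z, (f z * Real.log (f z) - f z * Real.log (f₁ z.1) - f z * Real.log (f₂ z.2)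
      + f z * Real.log c - f z + f₁ z.1 * f₂ z.2 * c⁻¹) ∂(μ.prod ν) := by
    refine integral_nonneg fun z => ?_
    have p0 : 0 < f z := hm.trans_le (h z).1
    have p1 : 0 < f₁ z.1 := hm.trans_le (b₁ _).1
    have p2 : 0 < f₂ z.2 := hm.trans_le (b₂ _).1
    have hl := Real.log_le_sub_one_of_pos (x := f₁ z.1 * f₂ z.2 / (f z * c)) (by positivity)
    rw [Real.log_div (by positivity) (by positivity), Real.log_mul p1.ne' p2.ne',
      Real.log_mul p0.ne' hcpos.ne'] at hl
    have := mul_le_mul_of_nonneg_left hl p0.le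
    have e : f z * (f₁ z.1 * f₂ z.2 / (f z * c) - 1) = f₁ z.1 * f₂ z.2 * c⁻¹ - f z := by
      field_simp
    rw [e] at this
    simp only [Pi.zero_apply]
    linarith
  have i3 := hfi.mul_const (Real.log c)
  have i4 := i12.mul_const c⁻¹
  have j1 : Integrable (fun z => f z * Real.log (f z) - f z * Real.log (f₁ z.1)) (μ.prod ν) :=
    i0.sub i1
  have j2 : Integrable (fun z => f z * Real.log (f z) - f z * Real.log (f₁ z.1)
      - f z * Real.log (f₂ z.2)) (μ.prod ν) := j1.sub i2
  have j3 : Integrable (fun z => f z * Real.log (f z) - f z * Real.log (f₁ z.1)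
      - f z * Real.log (f₂ z.2) + f z * Real.log c) (μ.prod ν) := j2.add i3
  have j4 : Integrable (fun z => f z * Real.log (f z) - f z * Real.log (f₁ z.1)
      - f z * Real.log (f₂ z.2) + f z * Real.log c - f z) (μ.prod ν) := j3.sub hfi
  rw [integral_add j4 i4, integral_sub j3 hfi, integral_add j2 i3, integral_sub j1 i2,
    integral_sub i0 i1, e1, e2, integral_mul_const,
    integral_mul_const, e12, mul_assoc, mul_inv_cancel₀ hcpos.ne'] at key
  have r1 : ∫ x, entropyFun ν (fun y => f (x, y)) ∂μ
      = ∫ z, f z * Real.log (f z) ∂(μ.prod ν) - ∫ x, f₁ x * Real.log (f₁ x) ∂μ := by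
    rw [integral_prod _ i0, ← integral_sub i0.integral_prod_left
      (integrable_mul_log_of_mem_Icc hm m₁ b₁ m₁ b₁)]
    rfl
  have r2 : ∫ y, entropyFun μ (fun x => f (x, y)) ∂ν
      = ∫ z, f z * Real.log (f z) ∂(μ.prod ν) - ∫ y, f₂ y * Real.log (f₂ y) ∂ν := by
    rw [integral_prod_symm _ i0, ← integral_sub i0.integral_prod_right
      (integrable_mul_log_of_mem_Icc hm m₂ b₂ m₂ b₂)]
    rfl
  rw [r1, r2, entropyFun, ← hc]
  linarith

end

lemma integral_pi_succ {n : ℕ} (μ : Fin (n + 1) → Measure ℝ) [∀ i, IsProbabilityMeasure (μ i)]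
    (g : (Fin (n + 1) → ℝ) → ℝ) :
    ∫ x, g x ∂(Measure.pi μ)
      = ∫ z : ℝ × (Fin n → ℝ), g (Fin.cons z.1 z.2)
        ∂((μ 0).prod (Measure.pi fun i : Fin n => μ i.succ)) := by
  have h := (measurePreserving_piFinSuccAbove μ 0).symm
  rw [← h.integral_comp (MeasurableEquiv.measurableEmbedding _)]
  simp [Fin.insertNthEquiv, Fin.insertNth_zero', Fin.zero_succAbove]

lemma measurable_fin_cons {n : ℕ} :
    Measurable fun z : ℝ × (Fin n → ℝ) => (Fin.cons z.1 z.2 : Fin (n + 1) → ℝ) :=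
  measurable_pi_lambda _ fun i => by
    refine Fin.cases ?_ (fun j => ?_) i
    · exact measurable_fst
    · exact (measurable_pi_apply j).comp measurable_snd

/-- Tensorization of entropy: an entropy bound in each coordinate gives one for the product. -/
theorem entropyFun_pi_le {m M : ℝ} (hm : 0 < m) : ∀ {n : ℕ} (μ : Fin n → Measure ℝ)
    [∀ i, IsProbabilityMeasure (μ i)] (f : (Fin n → ℝ) → ℝ) (_ : Measurable f)
    (_ : ∀ x, f x ∈ Set.Icc m M) (Γ : Fin n → (Fin n → ℝ) → ℝ) (_ : ∀ i, Measurable (Γ i)) (C : ℝ)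
    (_ : ∀ i x, |Γ i x| ≤ C)
    (_ : ∀ i x, entropyFun (μ i) (fun s => f (Function.update x i s))
      ≤ ∫ s, Γ i (Function.update x i s) ∂(μ i)),
    entropyFun (Measure.pi μ) f ≤ ∫ x, ∑ i, Γ i x ∂(Measure.pi μ) := by
  intro n
  induction n with
  | zero =>
    intro μ _ f _ hfb Γ _ C _ _
    have : entropyFun (Measure.pi μ) f = 0 := by
      have e : f = fun _ => f default := funext fun x => congrArg f (Subsingleton.elim _ _)
      rw [e, entropyFun]
      simp
    rw [this]
    simp
  | succ n ih =>
    intro μ _ f hf hfb Γ hΓ C hC h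
    set ν := Measure.pi fun i : Fin n => μ i.succ with hν
    have hfc : Measurable fun z : ℝ × (Fin n → ℝ) => f (Fin.cons z.1 z.2) :=
      hf.comp measurable_fin_cons
    have hΓc : ∀ i, Measurable fun z : ℝ × (Fin n → ℝ) => Γ i (Fin.cons z.1 z.2) := fun i =>
      (hΓ i).comp measurable_fin_cons
    have hΓi : ∀ i, Integrable (fun z : ℝ × (Fin n → ℝ) => Γ i (Fin.cons z.1 z.2))
        ((μ 0).prod ν) := fun i =>
      Integrable.of_bound (hΓc i).aestronglyMeasurable C (Eventually.of_forall fun z => hC _ _)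
    have e0 : entropyFun (Measure.pi μ) f
        = entropyFun ((μ 0).prod ν) fun z => f (Fin.cons z.1 z.2) := by
      simp only [entropyFun, integral_pi_succ μ]
      rfl
    have s1 : ∫ x, entropyFun (μ 0) (fun s => f (Fin.cons s x)) ∂ν
        ≤ ∫ z : ℝ × (Fin n → ℝ), Γ 0 (Fin.cons z.1 z.2) ∂((μ 0).prod ν) := by
      rw [integral_prod_symm _ (hΓi 0)]
      refine integral_mono ?_ (hΓi 0).integral_prod_right fun x => ?_
      · exact integrable_entropyFun_snd (μ := ν) (ν := μ 0) hm (hfc.comp measurable_swap)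
          fun z => hfb _
      · have := h 0 (Fin.cons 0 x)
        simpa only [Fin.update_cons_zero] using this
    have s2 : ∫ s, entropyFun ν (fun x => f (Fin.cons s x)) ∂(μ 0)
        ≤ ∫ z : ℝ × (Fin n → ℝ), ∑ i : Fin n, Γ i.succ (Fin.cons z.1 z.2) ∂((μ 0).prod ν) := by
      have hi := integrable_finsetSum Finset.univ
        fun (i : Fin n) (_ : i ∈ Finset.univ) => hΓi i.succ
      rw [integral_prod _ hi]
      refine integral_mono ?_ hi.integral_prod_left fun s => ?_
      · exact integrable_entropyFun_snd hm hfc fun z => hfb _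
      · refine ih (fun i => μ i.succ) (fun x => f (Fin.cons s x)) (hfc.comp measurable_prodMk_left) (fun x => hfb _)
          (fun i x => Γ i.succ (Fin.cons s x))
          (fun i => (hΓc i.succ).comp measurable_prodMk_left) C (fun i x => hC _ _) fun i x => ?_
        have := h i.succ (Fin.cons s x)
        simpa only [← Fin.cons_update] using this
    have e1 : ∫ x, ∑ i, Γ i x ∂(Measure.pi μ)
        = ∫ z : ℝ × (Fin n → ℝ), Γ 0 (Fin.cons z.1 z.2) ∂((μ 0).prod ν)
          + ∫ z : ℝ × (Fin n → ℝ), ∑ i : Fin n, Γ i.succ (Fin.cons z.1 z.2) ∂((μ 0).prod ν) := by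
      rw [integral_pi_succ μ, ← integral_add (hΓi 0) (integrable_finsetSum _ fun i _ => hΓi _)]
      simp only [Fin.sum_univ_succ]
      rfl
    rw [e0, e1]
    exact (entropyFun_prod_le hm hfc fun z => hfb _).trans (add_le_add s1 s2)

/-- The logarithmic Sobolev inequality applied to `exp (h / 2)`. -/
lemma SatisfiesLSI.entropyFun_exp_le {ν : Measure ℝ} [IsProbabilityMeasure ν] {c : ℝ}
    (hν : SatisfiesLSI ν c) {h h' : ℝ → ℝ} (hh : ∀ s, HasDerivAt h (h' s) s) {B B' : ℝ}
    (hB : ∀ s, |h s| ≤ B) (hB' : ∀ s, |h' s| ≤ B') :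
    entropyFun ν (fun s => Real.exp (h s)) ≤ ∫ s, c / 2 * h' s ^ 2 * Real.exp (h s) ∂ν := by
  -- For `g = exp(h/2)` one has `g² = exp h` and `g'² = h'² exp(h)/4`, which turns the LSI factor
  -- `2c` into `c/2`.
  have hd : ∀ s, HasDerivAt (fun s => Real.exp (h s / 2)) (Real.exp (h s / 2) * (h' s / 2)) s :=
    fun s => ((hh s).div_const 2).exp
  have hdiff : Differentiable ℝ h := fun s => (hh s).differentiableAt
  have hh'm : Measurable h' := by
    have : h' = deriv h := funext fun s => (hh s).deriv.symm
    rw [this]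
    exact measurable_deriv h
  have hsq : ∀ s, Real.exp (h s / 2) ^ 2 = Real.exp (h s) := fun s => by
    rw [← Real.exp_nat_mul]
    congr 1
    push_cast
    ring
  have hm : Measurable fun s => Real.exp (h s) := hdiff.continuous.measurable.exp
  have hmem : ∀ s, Real.exp (h s) ∈ Set.Icc (Real.exp (-B)) (Real.exp B) := fun s =>
    ⟨Real.exp_le_exp.2 (abs_le.1 (hB s)).1, Real.exp_le_exp.2 (abs_le.1 (hB s)).2⟩
  have hi := integrable_of_mem_Icc (μ := ν) hm hmem
  have hpos : 0 < ∫ s, Real.exp (h s) ∂ν :=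
    (Real.exp_pos _).trans_le (integral_mem_Icc (μ := ν) hm hmem).1
  have hderiv : (fun s => |deriv (fun s => Real.exp (h s / 2)) s| ^ 2)
      = fun s => h' s ^ 2 / 4 * Real.exp (h s) := by
    funext s
    rw [(hd s).deriv, sq_abs, mul_pow, hsq]
    ring
  have hi' : Integrable (fun s => h' s ^ 2 / 4 * Real.exp (h s)) ν := by
    refine hi.bdd_mul (c := B' ^ 2 / 4) ((hh'm.pow_const 2).div_const 4).aestronglyMeasurable
      (Eventually.of_forall fun s => ?_)
    rw [Real.norm_of_nonneg (by positivity), ← sq_abs]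
    gcongr
    exact hB' s
  have key := (hν (fun s => Real.exp (h s / 2)) (fun s => (hd s).differentiableAt)
    (by simpa only [hsq] using hi) (by rw [hderiv]; exact hi')).2
  rw [hderiv] at key
  simp only [hsq] at key
  have il := integrable_mul_log_of_mem_Icc (μ := ν) (Real.exp_pos _) hm hmem hm hmem
  have e1 : ∫ s, Real.exp (h s) * Real.log (Real.exp (h s) / ∫ y, Real.exp (h y) ∂ν) ∂ν
      = entropyFun ν fun s => Real.exp (h s) := by
    rw [entropyFun, ← integral_mul_const, ← integral_sub il (hi.mul_const _)]
    refine integral_congr_ae (Eventually.of_forall fun s => ?_)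
    simp only
    rw [Real.log_div (Real.exp_pos _).ne' hpos.ne']
    ring
  rw [e1] at key
  refine key.trans_eq ?_
  rw [← integral_const_mul]
  congr 1
  funext s
  ring

end Entropy

/-! ### Herbst's argument and concentration under the LSI -/

section Herbst

open Filter Topology

variable {Ω : Type*} [MeasurableSpace Ω] {P : Measure Ω} [IsProbabilityMeasure P]

/-- Herbst's argument: an entropy bound yields a Gaussian bound on exponential moments. -/
theorem integral_exp_le_of_entropyFun_le {Y : Ω → ℝ} (hY : Measurable Y) {B v : ℝ}
    (hB : ∀ ω, |Y ω| ≤ B)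
    (h : ∀ t : ℝ, 0 ≤ t → entropyFun P (fun ω => Real.exp (t * Y ω))
      ≤ v * t ^ 2 / 2 * ∫ ω, Real.exp (t * Y ω) ∂P) {t : ℝ} (ht : 0 ≤ t) :
    ∫ ω, Real.exp (t * Y ω) ∂P ≤ Real.exp (t * ∫ ω, Y ω ∂P + v * t ^ 2 / 2) := by
  have hset : integrableExpSet Y P = Set.univ := by
    refine Set.eq_univ_of_forall fun s => ?_
    refine Integrable.of_bound (hY.const_mul s).exp.aestronglyMeasurable (Real.exp (|s| * B))
      (Eventually.of_forall fun ω => ?_)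
    rw [Real.norm_eq_abs, Real.abs_exp, Real.exp_le_exp]
    refine (le_abs_self _).trans ?_
    rw [abs_mul]
    exact mul_le_mul_of_nonneg_left (hB ω) (abs_nonneg _)
  have hint : ∀ s, s ∈ interior (integrableExpSet Y P) := fun s => by simp [hset]
  have hmgf : ∀ s, 0 < mgf Y P s := fun s => mgf_pos (by
    have : s ∈ integrableExpSet Y P := by simp [hset]
    exact this)
  have hd : ∀ s, HasDerivAt (cgf Y P) ((∫ ω, Y ω * Real.exp (s * Y ω) ∂P) / mgf Y P s) s :=
    fun s => by
      have := (analyticAt_cgf (hint s)).differentiableAt.hasDerivAt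
      rwa [deriv_cgf (hint s)] at this
  have hent : ∀ s, 0 ≤ s →
      s * ((∫ ω, Y ω * Real.exp (s * Y ω) ∂P) / mgf Y P s) - cgf Y P s ≤ v * s ^ 2 / 2 := by
    intro s hs
    have h1 := h s hs
    have e1 : ∫ ω, Real.exp (s * Y ω) * Real.log (Real.exp (s * Y ω)) ∂P
        = s * ∫ ω, Y ω * Real.exp (s * Y ω) ∂P := by
      rw [← integral_const_mul]
      congr 1
      funext ω
      rw [Real.log_exp]
      ring
    rw [entropyFun, e1] at h1
    change s * _ - mgf Y P s * cgf Y P s ≤ v * s ^ 2 / 2 * mgf Y P s at h1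
    have hp := hmgf s
    rw [← mul_div_assoc, sub_le_iff_le_add, div_le_iff₀ hp]
    linarith
  rcases ht.eq_or_lt with rfl | htpos
  · simp
  -- The entropy bound says that `cgf s / s` has derivative at most `v/2`, so `u` is antitone on
  -- `(0, ∞)`. Its limit at `0⁺` is the derivative of `cgf` at `0`, the mean.
  set u : ℝ → ℝ := fun s => cgf Y P s / s - v * s / 2 with hu
  have hud : ∀ s ∈ Set.Ioi (0 : ℝ), HasDerivAt u
      ((((∫ ω, Y ω * Real.exp (s * Y ω) ∂P) / mgf Y P s) * s - cgf Y P s * 1) / s ^ 2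
        - v * 1 / 2) s := fun s hs =>
    ((hd s).div (hasDerivAt_id s) (ne_of_gt hs)).sub (((hasDerivAt_id s).const_mul v).div_const 2)
  have hanti : AntitoneOn u (Set.Ioi 0) := by
    refine antitoneOn_of_deriv_nonpos (convex_Ioi 0)
      (fun s hs => (hud s hs).continuousAt.continuousWithinAt)
      (fun s hs => (hud s (interior_subset hs)).differentiableAt.differentiableWithinAt)
      fun s hs => ?_
    rw [interior_Ioi] at hs
    rw [(hud s hs).deriv, sub_nonpos, div_le_iff₀ (pow_pos hs 2)]
    have := hent s (le_of_lt hs)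
    linarith
  have hlim : Tendsto u (𝓝[>] 0) (𝓝 (∫ ω, Y ω ∂P)) := by
    have h0 := (hasDerivAt_iff_tendsto_slope_zero.1 (hd 0)).mono_left
      (nhdsWithin_mono 0 (fun s (hs : s ∈ Set.Ioi (0 : ℝ)) => ne_of_gt hs))
    have h1 : Tendsto (fun s : ℝ => v * s / 2) (𝓝[>] 0) (𝓝 0) := by
      have : Tendsto (fun s : ℝ => v * s / 2) (𝓝 0) (𝓝 (v * 0 / 2)) :=
        Continuous.tendsto (by fun_prop) 0
      rw [mul_zero, zero_div] at this
      exact this.mono_left nhdsWithin_le_nhds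
    have h2 := h0.sub h1
    simp only [zero_add, cgf_zero, sub_zero, smul_eq_mul, zero_mul, Real.exp_zero, mul_one,
      mgf_zero, div_one] at h2
    refine h2.congr fun s => ?_
    rw [hu]
    ring
  have hle : u t ≤ ∫ ω, Y ω ∂P := by
    refine ge_of_tendsto hlim ?_
    filter_upwards [Ioc_mem_nhdsGT htpos] with s hs
    exact hanti hs.1 htpos hs.2
  have : cgf Y P t ≤ t * ∫ ω, Y ω ∂P + v * t ^ 2 / 2 := by
    have h3 := mul_le_mul_of_nonneg_left hle ht
    have h4 : t * u t = cgf Y P t - v * t ^ 2 / 2 := by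
      rw [hu]
      field_simp
    linarith
  change mgf Y P t ≤ _
  rwa [← Real.log_le_iff_le_exp (hmgf t)]

/-- Concentration of bounded smooth Lipschitz functions under logarithmic Sobolev inequalities. -/
lemma SatisfiesLSI.integral_exp_le_of_bounded {n : ℕ} {X : Fin n → Ω → ℝ}
    (hX : ∀ i, Measurable (X i)) (hindep : iIndepFun X P) {c K B t : ℝ} (hc : 0 ≤ c)
    (hLSI : ∀ i, SatisfiesLSI (P.map (X i)) c) {F : (Fin n → ℝ) → ℝ} (hF : Measurable F)
    (hB : ∀ x, |F x| ≤ B) {G : Fin n → (Fin n → ℝ) → ℝ} (hG : ∀ i, Measurable (G i))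
    (hFG : ∀ i x s, HasDerivAt (fun s => F (Function.update x i s)) (G i (Function.update x i s)) s)
    (hK : ∀ x, ∑ i, G i x ^ 2 ≤ K) (ht : 0 ≤ t) :
    ∫ ω, Real.exp (t * F (fun i => X i ω)) ∂P
      ≤ Real.exp (t * ∫ ω, F (fun i => X i ω) ∂P + c * K * t ^ 2 / 2) := by
  have hm : Measurable fun ω i => X i ω := measurable_pi_lambda _ hX
  have : ∀ i, IsProbabilityMeasure (P.map (X i)) :=
    fun i => Measure.isProbabilityMeasure_map (hX i).aemeasurable
  set μ := Measure.pi fun i => P.map (X i) with hμ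
  have hmap : P.map (fun ω i => X i ω) = μ :=
    (iIndepFun_iff_map_fun_eq_pi_map fun i => (hX i).aemeasurable).1 hindep
  have hK0 : 0 ≤ K := (Finset.sum_nonneg fun i _ => sq_nonneg _).trans (hK 0)
  have hGK : ∀ i x, |G i x| ≤ √K := fun i x => by
    refine Real.abs_le_sqrt (le_trans ?_ (hK x))
    exact Finset.single_le_sum (f := fun i => G i x ^ 2) (fun i _ => sq_nonneg _)
      (Finset.mem_univ i)
  rw [← integral_map (φ := fun ω i => X i ω) (f := F) hm.aemeasurable hF.aestronglyMeasurable,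
    ← integral_map (φ := fun ω i => X i ω) (f := fun x => Real.exp (t * F x)) hm.aemeasurable
      (hF.const_mul t).exp.aestronglyMeasurable, hmap]
  refine integral_exp_le_of_entropyFun_le hF hB (fun r hr => ?_) ht
  have hmem : ∀ x, Real.exp (r * F x) ∈ Set.Icc (Real.exp (-(r * B))) (Real.exp (r * B)) := by
    intro x
    have := abs_le.1 (hB x)
    constructor
    · rw [Real.exp_le_exp, ← mul_neg]
      exact mul_le_mul_of_nonneg_left this.1 hr
    · rw [Real.exp_le_exp]
      exact mul_le_mul_of_nonneg_left this.2 hr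
  have hem : Measurable fun x => Real.exp (r * F x) := (hF.const_mul r).exp
  have hei := integrable_of_mem_Icc (μ := μ) hem hmem
  have hΓm : ∀ i, Measurable fun x => c / 2 * (r * G i x) ^ 2 * Real.exp (r * F x) := fun i =>
    ((((hG i).const_mul r).pow_const 2).const_mul _).mul hem
  have hΓb : ∀ i x, |c / 2 * (r * G i x) ^ 2 * Real.exp (r * F x)|
      ≤ c / 2 * (r * √K) ^ 2 * Real.exp (r * B) := by
    intro i x
    rw [abs_of_nonneg (by positivity), mul_pow, mul_pow, ← sq_abs (G i x)]
    have := (hmem x).2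
    have := hGK i x
    gcongr
  have key := entropyFun_pi_le (Real.exp_pos _) (fun i => P.map (X i)) _ hem hmem
    (fun i x => c / 2 * (r * G i x) ^ 2 * Real.exp (r * F x)) hΓm _ hΓb (fun i x =>
      (hLSI i).entropyFun_exp_le (h' := fun s => r * G i (Function.update x i s))
        (fun s => (hFG i x s).const_mul r) (B := r * B) (B' := r * √K)
        (fun s => by
          rw [abs_mul, abs_of_nonneg hr]
          exact mul_le_mul_of_nonneg_left (hB _) hr)
        (fun s => by
          rw [abs_mul, abs_of_nonneg hr]
          exact mul_le_mul_of_nonneg_left (hGK _ _) hr))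
  refine key.trans ?_
  rw [← integral_const_mul]
  refine integral_mono ?_ (hei.const_mul _) fun x => ?_
  · exact integrable_finsetSum _ fun i _ => Integrable.of_bound (hΓm i).aestronglyMeasurable _
      (Eventually.of_forall fun x => hΓb i x)
  · simp only [mul_pow, ← Finset.sum_mul, ← Finset.mul_sum]
    have := mul_le_mul_of_nonneg_left (hK x) (by positivity : 0 ≤ c / 2 * r ^ 2)
    have := mul_le_mul_of_nonneg_right this (Real.exp_pos (r * F x)).le
    calc _ = c / 2 * r ^ 2 * (∑ i, G i x ^ 2) * Real.exp (r * F x) := by ring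
      _ ≤ _ := this
      _ = _ := by ring

lemma tendsto_mul_arctan_div (a : ℝ) :
    Tendsto (fun N : ℕ => ((N : ℝ) + 1) * Real.arctan (a / ((N : ℝ) + 1))) atTop (𝓝 a) := by
  have h0 : HasDerivAt (fun s : ℝ => Real.arctan (a * s)) a 0 := by
    have := ((hasDerivAt_id (0 : ℝ)).const_mul a).arctan
    simpa using this
  have h1 := hasDerivAt_iff_tendsto_slope_zero.1 h0
  have h2 : Tendsto (fun N : ℕ => 1 / ((N : ℝ) + 1)) atTop (𝓝[≠] 0) :=
    tendsto_nhdsWithin_iff.2 ⟨tendsto_one_div_add_atTop_nhds_zero_nat,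
      Eventually.of_forall fun N => by
        have : 1 / ((N : ℝ) + 1) ≠ 0 := by positivity
        exact this⟩
  refine (h1.comp h2).congr fun N => ?_
  simp [div_eq_mul_inv]

lemma abs_mul_arctan_div_le {r : ℝ} (hr : 0 < r) (a : ℝ) : |r * Real.arctan (a / r)| ≤ |a| := by
  have h : ∀ x : ℝ, 0 ≤ x → |Real.arctan x| ≤ x := fun x hx => by
    have h0 := Real.arctan_nonneg.2 hx
    rw [abs_of_nonneg h0]
    simpa using Real.le_tan h0 (Real.arctan_lt_pi_div_two x)
  have h' : |Real.arctan (a / r)| ≤ |a| / r := by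
    rcases le_total 0 a with ha | ha
    · rw [abs_of_nonneg ha]
      exact h _ (by positivity)
    · rw [abs_of_nonpos ha, ← abs_neg, ← Real.arctan_neg, ← neg_div]
      exact h _ (div_nonneg (by linarith) hr.le)
  rw [abs_mul, abs_of_pos hr]
  calc r * |Real.arctan (a / r)| ≤ r * (|a| / r) := by gcongr
    _ = |a| := mul_div_cancel₀ _ hr.ne'

/-- Concentration of smooth Lipschitz functions under logarithmic Sobolev inequalities. -/
theorem SatisfiesLSI.integral_exp_le {ι : Type*} [Fintype ι] [DecidableEq ι] {X : ι → Ω → ℝ}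
    (hX : ∀ i, Measurable (X i)) (hindep : iIndepFun X P) {c K t : ℝ} (hc : 0 ≤ c)
    (hLSI : ∀ i, SatisfiesLSI (P.map (X i)) c) {F : (ι → ℝ) → ℝ} (hF : Measurable F)
    {G : ι → (ι → ℝ) → ℝ} (hG : ∀ i, Measurable (G i))
    (hFG : ∀ i x s, HasDerivAt (fun s => F (Function.update x i s)) (G i (Function.update x i s)) s)
    (hK : ∀ x, ∑ i, G i x ^ 2 ≤ K) (hFi : Integrable (fun ω => F (fun i => X i ω)) P)
    (ht : 0 ≤ t) :
    Integrable (fun ω => Real.exp (t * F (fun i => X i ω))) P ∧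
    ∫ ω, Real.exp (t * F (fun i => X i ω)) ∂P
      ≤ Real.exp (t * ∫ ω, F (fun i => X i ω) ∂P + c * K * t ^ 2 / 2) := by
  have hm : Measurable fun ω i => X i ω := measurable_pi_lambda _ hX
  -- A smooth bounded truncation with slope in `(0, 1]`: it preserves the gradient bound, converges
  -- to the identity, and satisfies `|T N a| ≤ |a|`.
  set T : ℕ → ℝ → ℝ := fun N a => ((N : ℝ) + 1) * Real.arctan (a / ((N : ℝ) + 1)) with hT
  have hTm : ∀ N, Measurable (T N) := fun N => by
    have : Continuous (T N) := by
      have h : ∀ x : ℝ, (N : ℝ) + 1 ≠ 0 := fun _ => by positivity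
      simp only [hT]
      fun_prop
    exact this.measurable
  have hTd : ∀ N a, HasDerivAt (T N) (1 / (1 + (a / ((N : ℝ) + 1)) ^ 2)) a := fun N a => by
    refine ((((hasDerivAt_id a).div_const ((N : ℝ) + 1)).arctan).const_mul
      ((N : ℝ) + 1)).congr_deriv ?_
    have : (N : ℝ) + 1 ≠ 0 := by positivity
    simp only [id]
    field_simp
  have hFm : Measurable fun ω => F (fun i => X i ω) := hF.comp hm
  have hbd : ∀ N : ℕ, ∫ ω, Real.exp (t * T N (F (fun i => X i ω))) ∂P
      ≤ Real.exp (t * ∫ ω, T N (F (fun i => X i ω)) ∂P + c * K * t ^ 2 / 2) := by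
    intro N
    let e := Fintype.equivFin ι
    have hsum : ∀ g : ι → ℝ, ∑ i, g (e.symm i) = ∑ i, g i := fun g => e.symm.sum_comp g
    have hpm : Measurable fun (x : Fin (Fintype.card ι) → ℝ) (i : ι) => x (e i) :=
      measurable_pi_lambda _ fun i => measurable_pi_apply _
    have hupd : ∀ (x : Fin (Fintype.card ι) → ℝ) j s, (fun i => Function.update x j s (e i))
        = Function.update (fun i => x (e i)) (e.symm j) s := by
      intro x j s
      funext i
      simp only [Function.update_apply, Equiv.eq_symm_apply]
    have := SatisfiesLSI.integral_exp_le_of_bounded (P := P) (X := fun i => X (e.symm i))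
      (fun i => hX _) (hindep.precomp e.symm.injective) (K := K) (t := t)
      (B := ((N : ℝ) + 1) * (Real.pi / 2)) hc (fun i => hLSI _)
      (F := fun x => T N (F (fun i => x (e i)))) ((hTm N).comp (hF.comp hpm))
      (fun x => by
        rw [hT, abs_mul, abs_of_nonneg (by positivity)]
        exact mul_le_mul_of_nonneg_left (abs_le.2 ⟨(Real.neg_pi_div_two_lt_arctan _).le,
          (Real.arctan_lt_pi_div_two _).le⟩) (by positivity))
      (G := fun j x => 1 / (1 + (F (fun i => x (e i)) / ((N : ℝ) + 1)) ^ 2)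
        * G (e.symm j) (fun i => x (e i)))
      (fun j => ((((hF.comp hpm).div_const _).pow_const 2).const_add 1 |>.const_div 1).mul
        ((hG _).comp hpm))
      (fun j x s => by
        simp only [hupd]
        exact (hTd N _).comp s (hFG (e.symm j) (fun i => x (e i)) s))
      (fun x => by
        refine le_trans ?_ (hK (fun i => x (e i)))
        rw [← hsum fun i => G i (fun i => x (e i)) ^ 2]
        refine Finset.sum_le_sum fun j _ => ?_
        rw [mul_pow]
        refine mul_le_of_le_one_left (sq_nonneg _) (pow_le_one₀ (by positivity) ?_)
        rw [div_le_one (by positivity)]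
        have := sq_nonneg (F (fun i => x (e i)) / ((N : ℝ) + 1))
        linarith) ht
    simpa using this
  have hlim : Tendsto (fun N => ∫ ω, T N (F (fun i => X i ω)) ∂P) atTop
      (𝓝 (∫ ω, F (fun i => X i ω) ∂P)) :=
    tendsto_integral_of_dominated_convergence (fun ω => |F (fun i => X i ω)|)
      (fun N => ((hTm N).comp hFm).aestronglyMeasurable) hFi.abs
      (fun N => Eventually.of_forall fun ω => abs_mul_arctan_div_le (by positivity) _)
      (Eventually.of_forall fun ω => tendsto_mul_arctan_div _)
  have hTi : ∀ N, Integrable (fun ω => Real.exp (t * T N (F (fun i => X i ω)))) P := fun N => by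
    refine Integrable.of_bound (((hTm N).comp hFm).const_mul t).exp.aestronglyMeasurable
      (Real.exp (t * (((N : ℝ) + 1) * (Real.pi / 2)))) (Eventually.of_forall fun ω => ?_)
    rw [Real.norm_eq_abs, Real.abs_exp]
    have := (Real.arctan_lt_pi_div_two (F (fun i => X i ω) / ((N : ℝ) + 1))).le
    simp only [hT]
    gcongr
  -- The means converge by dominated convergence, but the exponentials have no dominating function
  -- yet. Fatou's lemma gives the bound and integrability together.
  have hfatou : ∫⁻ ω, ENNReal.ofReal (Real.exp (t * F (fun i => X i ω))) ∂P
      ≤ ENNReal.ofReal (Real.exp (t * ∫ ω, F (fun i => X i ω) ∂P + c * K * t ^ 2 / 2)) := by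
    have e1 : ∀ ω, ENNReal.ofReal (Real.exp (t * F (fun i => X i ω)))
        = liminf (fun N => ENNReal.ofReal (Real.exp (t * T N (F (fun i => X i ω))))) atTop :=
      fun ω => (Tendsto.liminf_eq (ENNReal.tendsto_ofReal
        ((Real.continuous_exp.tendsto _).comp ((tendsto_mul_arctan_div _).const_mul t)))).symm
    simp only [e1]
    refine (lintegral_liminf_le fun N => ((((hTm N).comp hFm).const_mul t).exp).ennreal_ofReal).trans ?_
    have e2 : Tendsto (fun N => ENNReal.ofReal
        (Real.exp (t * ∫ ω, T N (F (fun i => X i ω)) ∂P + c * K * t ^ 2 / 2))) atTop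
        (𝓝 (ENNReal.ofReal (Real.exp (t * ∫ ω, F (fun i => X i ω) ∂P + c * K * t ^ 2 / 2)))) :=
      ENNReal.tendsto_ofReal ((Real.continuous_exp.tendsto _).comp
        ((hlim.const_mul t).add_const _))
    rw [← e2.liminf_eq]
    refine liminf_le_liminf (Eventually.of_forall fun N => ?_)
    exact (ofReal_integral_eq_lintegral_ofReal (hTi N)
      (Eventually.of_forall fun ω => (Real.exp_pos _).le)).symm.trans_le
        (ENNReal.ofReal_le_ofReal (hbd N))
  have hae : AEStronglyMeasurable (fun ω => Real.exp (t * F (fun i => X i ω))) P :=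
    (hFm.const_mul t).exp.aestronglyMeasurable
  refine ⟨⟨hae, ?_⟩, ?_⟩
  · rw [hasFiniteIntegral_iff_ofReal (Eventually.of_forall fun ω => (Real.exp_pos _).le)]
    exact hfatou.trans_lt ENNReal.ofReal_lt_top
  · rw [integral_eq_lintegral_of_nonneg_ae (Eventually.of_forall fun ω => (Real.exp_pos _).le) hae]
    exact ENNReal.toReal_le_of_le_ofReal (Real.exp_pos _).le hfatou

end Herbst

/-! ### Concentration of `logDetShift` for random matrices -/

section RandomMatrix

variable {Ω : Type*} [MeasurableSpace Ω] {P : Measure Ω} [IsProbabilityMeasure P] {k p : ℕ}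
  {A : Ω → Matrix (Fin k) (Fin p) ℝ}

/-- The matrix whose entries are the coordinates of a vector indexed by pairs. -/
def matrixOfCoords (x : Fin k × Fin p → ℝ) : Matrix (Fin k) (Fin p) ℝ :=
  Matrix.of fun i j => x (i, j)

lemma continuous_matrixOfCoords : Continuous (matrixOfCoords (k := k) (p := p)) :=
  continuous_matrix fun i j => continuous_apply (i, j)

lemma matrixOfCoords_update (x : Fin k × Fin p → ℝ) (i : Fin k) (j : Fin p) (s r : ℝ) :
    matrixOfCoords (Function.update x (i, j) r) = matrixOfCoords (Function.update x (i, j) s)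
      + (r - s) • Matrix.single i j 1 := by
  ext a b
  simp only [matrixOfCoords, Matrix.of_apply, Matrix.add_apply, Matrix.smul_apply, smul_eq_mul]
  by_cases hab : (a, b) = (i, j)
  · obtain ⟨rfl, rfl⟩ := Prod.mk.inj hab
    simp
  · have : ¬(i = a ∧ j = b) := fun h => hab (by rw [h.1, h.2])
    rw [Function.update_of_ne hab, Function.update_of_ne hab, Matrix.single_apply, if_neg this]
    ring

lemma matrixOfCoords_entries (M : Matrix (Fin k) (Fin p) ℝ) :
    matrixOfCoords (fun ij => M ij.1 ij.2) = M := rfl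

lemma continuous_logDetShift_matrixOfCoords {η : ℝ} (hη : 0 < η) :
    Continuous fun x : Fin k × Fin p → ℝ => logDetShift η (matrixOfCoords x) :=
  (continuous_logDetShift hη).comp continuous_matrixOfCoords

lemma measurable_logDetShift_comp (hmeas : ∀ i j, Measurable fun ω => A ω i j) {η : ℝ}
    (hη : 0 < η) : Measurable fun ω => logDetShift η (A ω) := by
  have h : Measurable fun ω (ij : Fin k × Fin p) => A ω ij.1 ij.2 :=
    measurable_pi_lambda _ fun ij => hmeas _ _
  simpa only [Function.comp_def, matrixOfCoords_entries] using
    (continuous_logDetShift_matrixOfCoords hη).measurable.comp h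

lemma integrable_logDetShift (hmeas : ∀ i j, Measurable fun ω => A ω i j)
    (hL2 : ∀ i j, MemLp (fun ω => A ω i j) 2 P) {η : ℝ} (hη : 0 < η) :
    Integrable (fun ω => logDetShift η (A ω)) P := by
  have hsq : Integrable (fun ω => ∑ i, ∑ j, A ω i j ^ 2) P :=
    integrable_finsetSum _ fun i _ => integrable_finsetSum _ fun j _ => (hL2 i j).integrable_sq
  refine integrable_of_le_of_le (measurable_logDetShift_comp hmeas hη).aestronglyMeasurable
    (Filter.Eventually.of_forall fun ω => le_logDetShift hη (A ω))
    (Filter.Eventually.of_forall fun ω => logDetShift_le hη (A ω)) (integrable_const _)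
    ((integrable_const _).add ((hsq.const_mul _).const_mul _))

lemma logDetShift_tail_of_integral_exp_le {η v δ : ℝ} (hv : 0 < v) (hδ : 0 ≤ δ)
    (h₁ : ∀ t : ℝ, 0 ≤ t → Integrable (fun ω => Real.exp (t * logDetShift η (A ω))) P ∧
      ∫ ω, Real.exp (t * logDetShift η (A ω)) ∂P
        ≤ Real.exp (t * ∫ ω, logDetShift η (A ω) ∂P + v * t ^ 2 / 2))
    (h₂ : ∀ t : ℝ, 0 ≤ t → Integrable (fun ω => Real.exp (t * -logDetShift η (A ω))) P ∧
      ∫ ω, Real.exp (t * -logDetShift η (A ω)) ∂P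
        ≤ Real.exp (t * ∫ ω, -logDetShift η (A ω) ∂P + v * t ^ 2 / 2)) :
    P.real {ω | (∫ ω', logDetShift η (A ω') ∂P) + δ ≤ logDetShift η (A ω)}
        ≤ Real.exp (-(δ ^ 2 / (2 * v))) ∧
      P.real {ω | logDetShift η (A ω) ≤ (∫ ω', logDetShift η (A ω') ∂P) - δ}
        ≤ Real.exp (-(δ ^ 2 / (2 * v))) := by
  refine ⟨measureReal_ge_le_of_integral_exp_le hv hδ h₁, ?_⟩
  have := measureReal_ge_le_of_integral_exp_le hv hδ h₂
  rw [integral_neg] at this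
  refine le_trans (measureReal_mono fun ω hω => ?_) this
  simp only [Set.mem_ofPred_eq] at hω ⊢
  linarith

/-- Two-sided concentration of `logDetShift` for bounded independent entries. -/
lemma logDetShift_tail_of_bounded (hk : 0 < k) (hmeas : ∀ i j, Measurable fun ω => A ω i j)
    (hindep : iIndepFun (fun (ij : Fin k × Fin p) (ω : Ω) => A ω ij.1 ij.2) P) {D η δ : ℝ}
    (hD : 0 < D) (hη : 0 < η) (hδ : 0 ≤ δ) (hA : ∀ i j, ∀ᵐ ω ∂P, |A ω i j| ≤ D) :
    P.real {ω | (∫ ω', logDetShift η (A ω') ∂P) + δ ≤ logDetShift η (A ω)}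
        ≤ Real.exp (-(η * δ ^ 2 / (16 * D ^ 2))) ∧
      P.real {ω | logDetShift η (A ω) ≤ (∫ ω', logDetShift η (A ω') ∂P) - δ}
        ≤ Real.exp (-(η * δ ^ 2 / (16 * D ^ 2))) := by
  obtain ⟨U, V, hU, hV, hUV⟩ := exists_logDetShift_sub_le (k := k) (p := p) hk hη
  have hc : Continuous fun x : Fin k × Fin p → ℝ => logDetShift η (matrixOfCoords x) :=
    continuous_logDetShift_matrixOfCoords hη
  have e : -(η * δ ^ 2 / (16 * D ^ 2)) = -(δ ^ 2 / (2 * (8 * D ^ 2 * (1 / η)))) := by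
    field_simp
    ring
  rw [e]
  refine logDetShift_tail_of_integral_exp_le (by positivity) hδ (fun t ht => ?_) fun t ht => ?_
  · have := integral_exp_le_of_bounded (X := fun ij ω => A ω ij.1 ij.2) (fun ij => hmeas _ _) hindep
      hD.le ht (fun ij => hA _ _) (F := fun x => logDetShift η (matrixOfCoords x)) hc (U := fun x ij => U (matrixOfCoords x) ij.1 ij.2)
      (V := fun x ij => V (matrixOfCoords x) ij.1 ij.2)
      (fun x => by rw [Fintype.sum_prod_type]; exact hU _)
      (fun x => by rw [Fintype.sum_prod_type]; exact hV _)
      (fun x y => by rw [Fintype.sum_prod_type]; exact hUV _ _)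
    simpa only [matrixOfCoords_entries] using this
  -- For `-L` the roles of the two points are exchanged, so `U` and `V` are swapped and change sign.
  · have := integral_exp_le_of_bounded (X := fun ij ω => A ω ij.1 ij.2) (fun ij => hmeas _ _) hindep
      hD.le ht (fun ij => hA _ _) (F := fun x => -logDetShift η (matrixOfCoords x)) hc.neg (U := fun x ij => -V (matrixOfCoords x) ij.1 ij.2)
      (V := fun x ij => -U (matrixOfCoords x) ij.1 ij.2)
      (fun x => by simp only [neg_sq]; rw [Fintype.sum_prod_type]; exact hV _)
      (fun x => by simp only [neg_sq]; rw [Fintype.sum_prod_type]; exact hU _)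
      (fun x y => by
        rw [Fintype.sum_prod_type, neg_sub_neg]
        refine (hUV _ _).trans_eq (Finset.sum_congr rfl fun i _ => Finset.sum_congr rfl fun j _ => ?_)
        simp only [matrixOfCoords, Matrix.of_apply]
        ring)
    simpa only [matrixOfCoords_entries] using this

/-- Two-sided concentration of `logDetShift` under logarithmic Sobolev inequalities. -/
lemma logDetShift_tail_of_satisfiesLSI (hk : 0 < k) (hmeas : ∀ i j, Measurable fun ω => A ω i j)
    (hindep : iIndepFun (fun (ij : Fin k × Fin p) (ω : Ω) => A ω ij.1 ij.2) P) {c η δ : ℝ}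
    (hc : 0 < c) (hη : 0 < η) (hδ : 0 ≤ δ)
    (hLSI : ∀ i j, SatisfiesLSI (P.map fun ω => A ω i j) c)
    (hint : Integrable (fun ω => logDetShift η (A ω)) P) :
    P.real {ω | (∫ ω', logDetShift η (A ω') ∂P) + δ ≤ logDetShift η (A ω)}
        ≤ Real.exp (-(η * δ ^ 2 / (2 * c))) ∧
      P.real {ω | logDetShift η (A ω) ≤ (∫ ω', logDetShift η (A ω') ∂P) - δ}
        ≤ Real.exp (-(η * δ ^ 2 / (2 * c))) := by
  have hF : Continuous fun x : Fin k × Fin p → ℝ => logDetShift η (matrixOfCoords x) :=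
    continuous_logDetShift_matrixOfCoords hη
  have hG : ∀ ij : Fin k × Fin p, Continuous fun x => logDetShiftGrad η (matrixOfCoords x) ij.1 ij.2 :=
    fun ij => ((continuous_logDetShiftGrad hη).comp continuous_matrixOfCoords).matrix_elem _ _
  have hd : ∀ (ij : Fin k × Fin p) (x : Fin k × Fin p → ℝ) (s : ℝ),
      HasDerivAt (fun s => logDetShift η (matrixOfCoords (Function.update x ij s)))
        (logDetShiftGrad η (matrixOfCoords (Function.update x ij s)) ij.1 ij.2) s := by
    rintro ⟨i, j⟩ x s
    have h := hasDerivAt_logDetShift hη (matrixOfCoords (Function.update x (i, j) s)) i j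
    rw [← sub_self s] at h
    refine (h.comp_sub_const s s).congr_of_eventuallyEq (Filter.Eventually.of_forall fun r => ?_)
    simp only
    rw [matrixOfCoords_update x i j s r]
  have hK : ∀ x : Fin k × Fin p → ℝ, ∑ ij : Fin k × Fin p, logDetShiftGrad η (matrixOfCoords x) ij.1 ij.2 ^ 2 ≤ 1 / η := fun x => by
    rw [Fintype.sum_prod_type]
    exact sum_sq_logDetShiftGrad_le hk hη _
  have hint' : Integrable
      (fun ω => logDetShift η (matrixOfCoords fun ij : Fin k × Fin p => A ω ij.1 ij.2)) P := by
    simpa only [matrixOfCoords_entries] using hint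
  have e : -(η * δ ^ 2 / (2 * c)) = -(δ ^ 2 / (2 * (c * (1 / η)))) := by
    field_simp
  rw [e]
  refine logDetShift_tail_of_integral_exp_le (by positivity) hδ (fun t ht => ?_) fun t ht => ?_
  · have := SatisfiesLSI.integral_exp_le (ι := Fin k × Fin p)
      (X := fun ij ω => A ω ij.1 ij.2) (fun ij => hmeas _ _) hindep
      hc.le (fun ij => hLSI _ _) (F := fun x => logDetShift η (matrixOfCoords x))
      hF.measurable (G := fun ij x => logDetShiftGrad η (matrixOfCoords x) ij.1 ij.2)
      (fun ij => (hG ij).measurable) hd hK hint' ht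
    simpa only [matrixOfCoords_entries] using this
  · have := SatisfiesLSI.integral_exp_le (ι := Fin k × Fin p)
      (X := fun ij ω => A ω ij.1 ij.2) (fun ij => hmeas _ _) hindep
      hc.le (fun ij => hLSI _ _) (F := fun x => -logDetShift η (matrixOfCoords x))
      hF.measurable.neg (G := fun ij x => -logDetShiftGrad η (matrixOfCoords x) ij.1 ij.2)
      (fun ij => (hG ij).measurable.neg)
      (fun ij x s => (hd ij x s).neg) (fun x => by simpa only [neg_sq] using hK x) hint'.neg ht
    simpa only [matrixOfCoords_entries] using this

end RandomMatrix

/-! ### The tail bounds for `L_ε` -/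

theorem lemma1 {Ω : Type*} [MeasurableSpace Ω] (P : Measure Ω) [IsProbabilityMeasure P]
    (k p : ℕ) (hkp : (k : ℝ) / (p : ℝ) ∈ Set.Ioc (0 : ℝ) 1)
    (ε : ℝ) (hε : 0 < ε)
    (A : Ω → Matrix (Fin k) (Fin p) ℝ)
    (hmeas : ∀ i j, Measurable (fun ω => A ω i j))
    (hindep : iIndepFun (fun (ij : Fin k × Fin p) (ω : Ω) => A ω ij.1 ij.2) P)
    (hsymm : ∀ i j, IdentDistrib (fun ω => A ω i j) (fun ω => -A ω i j) P P)
    (hmean : ∀ i j, ∫ ω, A ω i j ∂P = 0)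
    (hvar : ∀ i j, variance (fun ω => A ω i j) P = 1) :
    (∀ η : ℝ, 0 < η → Integrable (fun ω => logDetShift η (A ω)) P) ∧
    (∀ D : ℝ, (∀ i j, ∀ᵐ ω ∂P, |A ω i j| ≤ D) →
      ∀ δ : ℝ, 8 * D * Real.sqrt Real.pi / Real.sqrt ε < δ →
        P.real {ω | logDetShift ε (A ω)
              < (∫ ω', logDetShift (2 * ε / Real.exp 1) (A ω') ∂P) - δ}
            ≤ 4 * Real.exp (-(ε * δ ^ 2 / (16 * D ^ 2))) ∧
        P.real {ω | logDetShift ε (A ω)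
              > (∫ ω', logDetShift (Real.exp 1 * ε / 2) (A ω') ∂P) + δ}
            ≤ 4 * Real.exp (-(ε * Real.exp 1 * δ ^ 2 / (32 * D ^ 2)))) ∧
    (∀ c : ℝ, (∀ i j, SatisfiesLSI (P.map (fun ω => A ω i j)) c) →
      ∀ δ : ℝ, 0 < δ →
        P.real {ω | |logDetShift ε (A ω) - ∫ ω', logDetShift ε (A ω') ∂P| > δ}
            ≤ 2 * Real.exp (-(ε * δ ^ 2 / (2 * c)))) := by

  have hk : 0 < k := by
    rcases Nat.eq_zero_or_pos k with rfl | h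
    · simp at hkp
    · exact h
  have hp : 0 < p := by
    rcases Nat.eq_zero_or_pos p with rfl | h
    · simp at hkp
    · exact h
  -- `variance` is `0` by convention outside `L²`, so unit variance yields square integrability.
  have hint : ∀ η : ℝ, 0 < η → Integrable (fun ω => logDetShift η (A ω)) P := fun η hη =>
    integrable_logDetShift hmeas (fun i j => memLp_two_of_variance_ne_zero
      (hmeas i j).aestronglyMeasurable (by rw [hvar]; exact one_ne_zero)) hη
  refine ⟨hint, ?_, ?_⟩
  · intro D hD δ hδ
    have hD0 : 0 ≤ D := by
      obtain ⟨ω, hω⟩ := (hD ⟨0, hk⟩ ⟨0, hp⟩).exists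
      exact (abs_nonneg _).trans hω
    have hδ0 : 0 ≤ δ := le_trans (by positivity) hδ.le
    rcases hD0.eq_or_lt with rfl | hDpos
    -- For `D = 0` division by zero makes the exponents `0`, and the bounds read `4`.
    · constructor <;> refine measureReal_le_one.trans ?_ <;> norm_num
    have he := Real.exp_one_gt_d9
    have hη : 0 < Real.exp 1 * ε / 2 := by positivity
    constructor
    -- The lower tail concentrates at level `ε` and compares means; the upper tail below
    -- concentrates at level `eε/2`, where the exponent gains the factor `e/2`, and compares the
    -- variables pointwise.
    · have h := (logDetShift_tail_of_bounded hk hmeas hindep hDpos hε hδ0 hD).2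
      have hle : ∫ ω, logDetShift (2 * ε / Real.exp 1) (A ω) ∂P ≤ ∫ ω, logDetShift ε (A ω) ∂P := by
        refine integral_mono (hint _ (by positivity)) (hint _ hε) fun ω =>
          logDetShift_mono (by positivity) ?_ _
        rw [div_le_iff₀ (Real.exp_pos 1)]
        nlinarith
      refine (measureReal_mono fun ω hω => ?_).trans (h.trans ?_)
      · simp only [Set.mem_ofPred_eq] at hω ⊢
        linarith
      · linarith [Real.exp_pos (-(ε * δ ^ 2 / (16 * D ^ 2)))]
    · have h := (logDetShift_tail_of_bounded hk hmeas hindep hDpos hη hδ0 hD).1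
      have hle : ∀ ω, logDetShift ε (A ω) ≤ logDetShift (Real.exp 1 * ε / 2) (A ω) := fun ω =>
        logDetShift_mono hε (by nlinarith) _
      have e : Real.exp 1 * ε / 2 * δ ^ 2 / (16 * D ^ 2)
          = ε * Real.exp 1 * δ ^ 2 / (32 * D ^ 2) := by
        field_simp
        ring
      rw [e] at h
      refine (measureReal_mono fun ω hω => ?_).trans (h.trans ?_)
      · simp only [Set.mem_ofPred_eq] at hω ⊢
        linarith [hle ω]
      · linarith [Real.exp_pos (-(ε * Real.exp 1 * δ ^ 2 / (32 * D ^ 2)))]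
  · intro c hc δ hδ
    rcases le_or_gt c 0 with hc0 | hc0
    -- For `c ≤ 0` the exponent is nonnegative, also under `x / 0 = 0`, so the bound exceeds any
    -- probability.
    · have h1 : 1 ≤ Real.exp (-(ε * δ ^ 2 / (2 * c))) := by
        rw [Real.one_le_exp_iff, neg_nonneg]
        exact div_nonpos_of_nonneg_of_nonpos (by positivity) (by linarith)
      linarith [measureReal_le_one (μ := P)
        (s := {ω | |logDetShift ε (A ω) - ∫ ω', logDetShift ε (A ω') ∂P| > δ})]
    · have h := logDetShift_tail_of_satisfiesLSI hk hmeas hindep hc0 hε hδ.le hc (hint ε hε)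
      refine (measureReal_mono (s₂ := {ω | (∫ ω', logDetShift ε (A ω') ∂P) + δ ≤ logDetShift ε (A ω)}
        ∪ {ω | logDetShift ε (A ω) ≤ (∫ ω', logDetShift ε (A ω') ∂P) - δ}) fun ω hω => ?_).trans
        ((measureReal_union_le _ _).trans (by linarith [h.1, h.2]))
      simp only [Set.mem_ofPred_eq, Set.mem_union] at hω ⊢
      rcases lt_abs.1 hω with h | h
      · left
        linarith
      · right
        linarith
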